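/- **Setting.** A class-probability-estimation (CPE) loss is a function $\ell(y,\hat y)$, $y\in\{0,1\}$, $\hat y\in(0,1)$, with real values. Let $P_r$ be a probability measure on $\{x\in\mathbb R^d:\|x\|_2\le B_x\}$ and $P_Z$ one on $\{z\in\mathbb R^p:\|z\|_2\le B_z\}$. With $\sigma(t)=1/(1+e^{-t})$ and $k,l\ge 1$, the discriminators and generators are the neural networks $$D_\omega(x)=\sigma\big(w_k^{\mathsf T}r_{k-1}(W_{k-1}r_{k-2}(\cdots r_1(W_1x)))\big),\qquad G_\theta(z)=V_l\,s_{l-1}(V_{l-1}s_{l-2}(\cdots s_1(V_1z))),$$ where the entrywise activations $r_i,s_j$ are positively homogeneous and $R_i$-, respectively $S_j$-Lipschitz. $\Omega$ is the set of all $\omega=(W_1,\dots,W_{k-1},w_k)$ with $\|W_i\|_F\le M_i$, $\|w_k\|_2\le M_k$, and $\Theta$ the set of all $\theta=(V_1,\dots,V_l)$ with $\|V_j\|_F\le N_j$. Put $$Q_x=\Big(M_k\prod_{i=1}^{k-1}M_iR_i\Big)B_x,\qquad Q_z=\Big(M_k\prod_{i=1}^{k-1}M_iR_i\Big)\Big(N_l\prod_{j=1}^{l-1}N_jS_j\Big)B_z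 .$$ Let $P_{G_\theta}$ be the law of $G_\theta(Z)$, $Z\sim P_Z$. For CPE losses $\ell_D,\ell_G$ put $\phi=-\ell_G(1,\cdot)$, $\psi=-\ell_G(0,\cdot)$ and $$d_\omega(P,Q)=\mathbb E_{X\sim P}[\phi(D_\omega(X))]+\mathbb E_{X\sim Q}[\psi(D_\omega(X))].$$ Suppose that for every $\theta\in\Theta$ an optimal discriminator $\omega^*(\theta)=\omega^*(P_r,P_{G_\theta})\in\arg\max_{\omega\in\Omega}\big(\mathbb E_{X\sim P_r}[-\ell_D(1,D_\omega(X))]+\mathbb E_{X\sim P_{G_\theta}}[-\ell_D(0,D_\omega(X))]\big)$ exists, and fix any choice of it. Given samples $X_1,\dots,X_n$ and $Z_1,\dots,Z_m$ ($n,m\ge1$) in the above balls, let $\hat P_r$ be the empirical measure of the $X_i$ and $\hat P_{G_\theta}$ that of the $G_\theta(Z_j)$; let $\hat\theta^*$ denote any minimizer over $\Theta$ of $\theta\mapsto d_{\omega^*(\theta)}(\hat P_r,\hat P_{G_\theta})$. Its estimation error is $$\mathcal E(\hat\theta^*)=d_{\omega^*(\hat\theta^*)}(P_r,P_{G_{\hat\theta^*}})-\inf_{\theta\in\Theta}d_{\omega^*(\theta)}(P_r,P_{G_\theta}).$$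 **Theorem.** 1. If $\ell_G(0,\cdot)$ and $\ell_G(1,\cdot)$ are continuous on $(0,1)$, then for all samples in the balls and every $\hat\theta^*$, $$\mathcal E(\hat\theta^*)\le 2\sup_{\omega\in\Omega}\Big|\mathbb E_{X\sim P_r}\phi(D_\omega(X))-\frac1n\sum_{i=1}^n\phi(D_\omega(X_i))\Big|+2\sup_{\omega\in\Omega,\theta\in\Theta}\Big|\mathbb E_{Z\sim P_Z}\psi(D_\omega(G_\theta(Z)))-\frac1m\sum_{j=1}^m\psi(D_\omega(G_\theta(Z_j)))\Big| .$$ For the remaining parts, let $X_1,\dots,X_n$ be i.i.d. with law $P_r$ and $Z_1,\dots,Z_m$ i.i.d. with law $P_Z$, and let $\delta\in(0,1)$. 2. If $\phi$ and $\psi$ are $L_\phi$- and $L_\psi$-Lipschitz on $(0,1)$, then each of the following two bounds holds for all minimizers $\hat\theta^*$ with probability at least $1-2\delta$ over the samples (i.e. the exceptional event has outer probability at most $2\delta$): $$\mathcal E(\hat\theta^*)\le 4\mathcal R_{S_x}+4\mathcal R_{S_z}+\sqrt{\log\tfrac1\delta}\Big(\frac{L_\phi Q_x}{\sqrt{2n}}+\frac{L_\psi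 Q_z}{\sqrt{2m}}\Big),$$ $$\mathcal E(\hat\theta^*)\le\frac{L_\phi Q_x\sqrt{3k}}{\sqrt n}+\frac{L_\psi Q_z\sqrt{3(k+l-1)}}{\sqrt m}+\sqrt{\log\tfrac1\delta}\Big(\frac{L_\phi Q_x}{\sqrt{2n}}+\frac{L_\psi Q_z}{\sqrt{2m}}\Big).$$ Here, with independent uniform signs $\epsilon_i\in\{-1,1\}$ that are independent of the samples, $\mathcal R_{S_x}=\mathbb E\sup_{\omega\in\Omega}\big|\frac1n\sum_{i=1}^n\epsilon_i\phi(D_\omega(X_i))\big|$ and $\mathcal R_{S_z}=\mathbb E\sup_{\omega\in\Omega,\theta\in\Theta}\big|\frac1m\sum_{j=1}^m\epsilon_j\psi(D_\omega(G_\theta(Z_j)))\big|$ are Rademacher complexities. 3. ($(\alpha_D,\alpha_G)$-GANs.) For $\alpha\in(0,\infty]$ let $\ell_\alpha(1,p)=\frac{\alpha}{\alpha-1}\big(1-p^{\frac{\alpha-1}{\alpha}}\big)$ and $\ell_\alpha(0,p)=\ell_\alpha(1,1-p)$, with the limits $\ell_1(1,p)=-\log p$ and $\ell_\infty(1,p)=1-p$.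 Let $$C_h(\alpha)=\begin{cases}\sigma(h)\,\sigma(-h)^{\frac{\alpha-1}{\alpha}},&0<\alpha\le1,\\ \big(\frac{\alpha-1}{2\alpha-1}\big)^{\frac{\alpha-1}{\alpha}}\frac{\alpha}{2\alpha-1},&1<\alpha<\infty,\\ \frac14,&\alpha=\infty.\end{cases}$$ If $\ell_D=\ell_{\alpha_D}$ and $\ell_G=\ell_{\alpha_G}$ with $\alpha_D,\alpha_G\in(0,\infty]$, then with probability at least $1-2\delta$, for all minimizers $\hat\theta^*$, $$\mathcal E(\hat\theta^*)\le\frac{4C_{Q_x}(\alpha_G)Q_x\sqrt{3k}}{\sqrt n}+\frac{4C_{Q_z}(\alpha_G)Q_z\sqrt{3(k+l-1)}}{\sqrt m}+2\sqrt{2\log\tfrac1\delta}\Big(\frac{C_{Q_x}(\alpha_G)Q_x}{\sqrt n}+\frac{C_{Q_z}(\alpha_G)Q_z}{\sqrt m}\Big).$$ -/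

import Mathlib

open MeasureTheory ProbabilityTheory
open scoped NNReal ENNReal

namespace DualGAN

/-- Frobenius norm of a real matrix. -/
noncomputable def frobNorm {a b : ℕ} (A : Matrix (Fin a) (Fin b) ℝ) : ℝ :=
  letI := Matrix.frobeniusNormedAddCommGroup (m := Fin a) (n := Fin b) (α := ℝ)
  ‖A‖

/-- The linear layer `x ↦ A x` between Euclidean spaces. -/
noncomputable def linLayer {a b : ℕ} (A : Matrix (Fin b) (Fin a) ℝ)
    (x : EuclideanSpace ℝ (Fin a)) : EuclideanSpace ℝ (Fin b) :=
  WithLp.toLp 2 (A.mulVec (WithLp.ofLp x))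

/-- The activation `ρ` applied to every coordinate. -/
noncomputable def entrywise {b : ℕ} (ρ : ℝ → ℝ) (x : EuclideanSpace ℝ (Fin b)) :
    EuclideanSpace ℝ (Fin b) :=
  WithLp.toLp 2 (fun j => ρ (x j))

/-- Output of the `i`-th hidden layer of a network with `K` hidden layers, widths `a` (`a 0` is the
input dimension), weight matrices `W` and activations `ρ`:
`h₀ = x` and `hᵢ₊₁ = ρᵢ (Wᵢ hᵢ)`. -/
noncomputable def hidden {K : ℕ} (a : ℕ → ℕ) (ρ : Fin K → ℝ → ℝ)
    (W : ∀ i : Fin K, Matrix (Fin (a (i + 1))) (Fin (a i)) ℝ)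
    (x : EuclideanSpace ℝ (Fin (a 0))) : ∀ i : ℕ, i ≤ K → EuclideanSpace ℝ (Fin (a i))
  | 0, _ => x
  | i + 1, h =>
      entrywise (ρ ⟨i, h⟩) (linLayer (W ⟨i, h⟩) (hidden a ρ W x i (Nat.le_of_succ_le h)))

/-- The architectures of the two networks. The discriminator has `k = K + 1` layers (`K` hidden
ones), the generator has `l = L + 1` layers (`L` hidden ones). `r`, `s` are the activation
functions, `R`, `S` their Lipschitz constants, and `M`, `Mout`, `N`, `Nout` the norm bounds on the
parameters. The data space is `ℝ ^ (dimD 0)`, the latent space is `ℝ ^ (dimG 0)`. -/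
structure Arch where
  K : ℕ
  L : ℕ
  dimD : ℕ → ℕ
  dimG : ℕ → ℕ
  r : Fin K → ℝ → ℝ
  s : Fin L → ℝ → ℝ
  R : Fin K → ℝ≥0
  S : Fin L → ℝ≥0
  M : Fin K → ℝ≥0
  Mout : ℝ≥0
  N : Fin L → ℝ≥0
  Nout : ℝ≥0
  r_lipschitz : ∀ i, LipschitzWith (R i) (r i)
  s_lipschitz : ∀ j, LipschitzWith (S j) (s j)
  r_posHom : ∀ i, ∀ c : ℝ, 0 ≤ c → ∀ p : ℝ, r i (c * p) = c * r i p
  s_posHom : ∀ j, ∀ c : ℝ, 0 ≤ c → ∀ p : ℝ, s j (c * p) = c * s j p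

namespace Arch

variable (A : Arch)

/-- The data space. -/
abbrev Data : Type := EuclideanSpace ℝ (Fin (A.dimD 0))

/-- The latent space. -/
abbrev Latent : Type := EuclideanSpace ℝ (Fin (A.dimG 0))

/-- Discriminator parameters `(W₁, …, W_{k-1}, w_k)`. -/
structure DParam where
  W : ∀ i : Fin A.K, Matrix (Fin (A.dimD (i + 1))) (Fin (A.dimD i)) ℝ
  w : EuclideanSpace ℝ (Fin (A.dimD A.K))

/-- Generator parameters `(V₁, …, V_{l-1}, V_l)`. -/
structure GParam where
  V : ∀ j : Fin A.L, Matrix (Fin (A.dimG (j + 1))) (Fin (A.dimG j)) ℝ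
  Vout : Matrix (Fin (A.dimD 0)) (Fin (A.dimG A.L)) ℝ

/-- The parameter set `Ω` of the discriminator. -/
def discSet : Set A.DParam :=
  {ω | (∀ i, frobNorm (ω.W i) ≤ A.M i) ∧ ‖ω.w‖ ≤ A.Mout}

/-- The parameter set `Θ` of the generator. -/
def genSet : Set A.GParam :=
  {θ | (∀ j, frobNorm (θ.V j) ≤ A.N j) ∧ frobNorm θ.Vout ≤ A.Nout}

variable {A}

/-- The discriminator `D_ω(x) = σ(w_kᵀ r_{k-1}(W_{k-1} ⋯ r₁(W₁ x)))`. -/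
noncomputable def disc (ω : A.DParam) (x : A.Data) : ℝ :=
  Real.sigmoid (inner ℝ ω.w (hidden A.dimD A.r ω.W x A.K le_rfl))

/-- The generator `G_θ(z) = V_l s_{l-1}(V_{l-1} ⋯ s₁(V₁ z))`. -/
noncomputable def gen (θ : A.GParam) (z : A.Latent) : A.Data :=
  linLayer θ.Vout (hidden A.dimG A.s θ.V z A.L le_rfl)

/-- The law `P_{G_θ}` of `G_θ(Z)` for `Z` of law `PZ`. -/
noncomputable def genLaw (PZ : Measure A.Latent) (θ : A.GParam) : Measure A.Data :=
  PZ.map (gen θ)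

/-- The value function `E_{X∼P}[-ℓ(1, D_ω(X))] + E_{X∼Q}[-ℓ(0, D_ω(X))]` of the CPE loss `ℓ`. -/
noncomputable def value (ℓ : Fin 2 → ℝ → ℝ) (ω : A.DParam) (P Q : Measure A.Data) : ℝ :=
  (∫ x, -ℓ 1 (disc ω x) ∂P) + ∫ x, -ℓ 0 (disc ω x) ∂Q

/-- `ωs θ` is an optimal discriminator `ω*(P_r, P_{G_θ})` for the loss `ℓD`,
for every generator parameter `θ ∈ Θ`. -/
def IsOptimalDisc (ℓD : Fin 2 → ℝ → ℝ) (Pr : Measure A.Data) (PZ : Measure A.Latent)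
    (ωs : A.GParam → A.DParam) : Prop :=
  ∀ θ ∈ A.genSet, ωs θ ∈ A.discSet ∧
    IsMaxOn (fun ω => value ℓD ω Pr (genLaw PZ θ)) A.discSet (ωs θ)

variable (A) in
/-- `Q_x = M_k ∏ (M_i R_i) B_x`. -/
noncomputable def Qx (Bx : ℝ) : ℝ := (A.Mout * ∏ i, (A.M i * A.R i : ℝ)) * Bx

variable (A) in
/-- `Q_z = (M_k ∏ (M_i R_i)) (N_l ∏ (N_j S_j)) B_z`. -/
noncomputable def Qz (Bz : ℝ) : ℝ :=
  (A.Mout * ∏ i, (A.M i * A.R i : ℝ)) * (A.Nout * ∏ j, (A.N j * A.S j : ℝ)) * Bz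

end Arch

open Arch

/-- The empirical measure of a finite sample. -/
noncomputable def empirical {E : Type*} [MeasurableSpace E] {n : ℕ} (x : Fin n → E) : Measure E :=
  (n : ℝ≥0∞)⁻¹ • ∑ i, Measure.dirac (x i)

/-- `θ` minimizes over `Θ` the generator's objective on the samples,
`θ ↦ d_{ω*(P_r, P_{G_θ})}(P̂_r, P̂_{G_θ})`. -/
def IsTrainedGen {A : Arch} (ℓG : Fin 2 → ℝ → ℝ) (ωs : A.GParam → A.DParam) {n m : ℕ}
    (x : Fin n → A.Data) (z : Fin m → A.Latent) (θ : A.GParam) : Prop :=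
  θ ∈ A.genSet ∧
    IsMinOn (fun θ' => value ℓG (ωs θ') (empirical x) (genLaw (empirical z) θ')) A.genSet θ

/-- The estimation error of the generator parameter `θ`:
`d_{ω*(P_r, P_{G_θ})}(P_r, P_{G_θ}) - inf_{θ'} d_{ω*(P_r, P_{G_θ'})}(P_r, P_{G_θ'})`. -/
noncomputable def estError {A : Arch} (ℓG : Fin 2 → ℝ → ℝ) (ωs : A.GParam → A.DParam)
    (Pr : Measure A.Data) (PZ : Measure A.Latent) (θ : A.GParam) : ℝ :=
  value ℓG (ωs θ) Pr (genLaw PZ θ)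
    - ⨅ θ' : A.genSet, value ℓG (ωs θ') Pr (genLaw PZ θ')

/-- Uniform deviation `sup_g |E_{Y∼P} g(Y) - (1/n) ∑ g(y_j)|` of a family of functions. -/
noncomputable def uniformDev {E ι : Type*} [MeasurableSpace E] (P : Measure E)
    (g : ι → E → ℝ) {n : ℕ} (y : Fin n → E) : ℝ :=
  ⨆ i, |(∫ e, g i e ∂P) - (1 / (n : ℝ)) * ∑ j, g i (y j)|

/-- Rademacher complexity `E_{Y,ε} sup_g |(1/n) ∑ ε_j g(Y_j)|`, where `Y₁, …, Y_n` are i.i.d. of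
law `P` and the signs `ε` are independent and uniform (average over the `2 ^ n` sign vectors). -/
noncomputable def rademacher {E ι : Type*} [MeasurableSpace E] (P : Measure E)
    (g : ι → E → ℝ) (n : ℕ) : ℝ :=
  ∫ y, (1 / (2 : ℝ) ^ n) * ∑ ε : Fin n → ℤˣ,
      ⨆ i, |(1 / (n : ℝ)) * ∑ j, ((ε j : ℤ) : ℝ) * g i (y j)|
    ∂(Measure.pi fun _ : Fin n => P)

/-- The functions `x ↦ φ(D_ω(x))` on the data space, `ω ∈ Ω`. -/
noncomputable def discFamily (A : Arch) (φ : ℝ → ℝ) : A.discSet → A.Data → ℝ :=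
  fun ω x => φ (disc ω.1 x)

/-- The functions `z ↦ ψ(D_ω(G_θ(z)))` on the latent space, `(ω, θ) ∈ Ω × Θ`. -/
noncomputable def discGenFamily (A : Arch) (ψ : ℝ → ℝ) :
    A.discSet × A.genSet → A.Latent → ℝ :=
  fun q z => ψ (disc q.1.1 (gen q.2.1 z))

/-- `ℓ_α(1, ·)`: `α/(α-1) (1 - p^((α-1)/α))`, with the limits `-log p` at `α = 1` and `1 - p` at
`α = ∞`. -/
noncomputable def alphaLossOne (α : ℝ≥0∞) (p : ℝ) : ℝ :=
  if α = ⊤ then 1 - p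
  else if α = 1 then -Real.log p
  else α.toReal / (α.toReal - 1) * (1 - p ^ ((α.toReal - 1) / α.toReal))

/-- The `α`-loss: `ℓ_α(1, p)` as above, and `ℓ_α(0, p) = ℓ_α(1, 1 - p)`. -/
noncomputable def alphaLoss (α : ℝ≥0∞) : Fin 2 → ℝ → ℝ :=
  fun y p => alphaLossOne α (if y = 1 then p else 1 - p)

/-- The constant `C_h(α)`: `σ(h) σ(-h)^((α-1)/α)` for `α ≤ 1`,
`((α-1)/(2α-1))^((α-1)/α) α/(2α-1)` for `1 < α < ∞`, and the limit `1/4` for `α = ∞`. -/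
noncomputable def clipConst (α : ℝ≥0∞) (h : ℝ) : ℝ :=
  if α = ⊤ then 1 / 4
  else if α ≤ 1 then
    Real.sigmoid h * Real.sigmoid (-h) ^ ((α.toReal - 1) / α.toReal)
  else
    ((α.toReal - 1) / (2 * α.toReal - 1)) ^ ((α.toReal - 1) / α.toReal)
      * (α.toReal / (2 * α.toReal - 1))

/-- For random samples `X`, `Z` on `(S, μ)`, with probability at least `1 - p` every trained
generator parameter has estimation error at most `b`. The exceptional set need not be measurable,
so the claim is that its outer measure is at most `p`. -/
def ErrorBoundWithFailure {A : Arch} {S : Type*} [MeasurableSpace S] (μ : Measure S)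
    (ℓG : Fin 2 → ℝ → ℝ) (ωs : A.GParam → A.DParam)
    (Pr : Measure A.Data) (PZ : Measure A.Latent) {n m : ℕ}
    (X : Fin n → S → A.Data) (Z : Fin m → S → A.Latent) (p b : ℝ) : Prop :=
  μ {t | ∃ θ, IsTrainedGen ℓG ωs (fun i => X i t) (fun j => Z j t) θ ∧
      b < estError ℓG ωs Pr PZ θ} ≤ ENNReal.ofReal p

end DualGAN

namespace DualGAN

/-! For each θ, the empirical and the population objective use the same discriminator ω*(θ). They
therefore differ by at most U + V, where U and V are the uniform deviations over Ω and over Ω × Θ.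
Comparing a minimizer of the first with an arbitrary competitor gives an estimation error of at most
2U + 2V (`estError_le_uniformDev`).

Composed with the sigmoid, the loss is a Λ-Lipschitz function F of a score in [-Q, Q], so each
member of the family oscillates by at most 2ΛQ. McDiarmid's inequality then puts U within 2ΛQ
√(log(1/δ)/(2n)) of its mean with probability 1 - δ. Symmetrization bounds that mean by twice the
Rademacher complexity, and a union bound handles V as well. Lipschitz φ, ψ give Λ = L/4, because σ'
≤ 1/4. For the α-loss, Λ is the maximum of the explicit derivative on [-Q, Q].

The explicit bound comes from peeling the network layer by layer inside an exponential moment, so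
that depth enters only as √k. Let M(c) be the sum over sign vectors of sup exp(c · process), kept in
`ℝ≥0∞` so that no boundedness is needed. By positive homogeneity, a layer of Frobenius norm at most
M is dominated by M times a single neuron with weights in the unit ball. Removing the absolute value
costs a factor 2, and an exponential contraction principle removes the activation at no further
cost. What remains is the norm of a Rademacher sum of the inputs, whose exponential moment is at
most 2 exp(nc²B²/2) on average. Taking logarithms and optimizing over c turns the 2^(k+1) into
√(3k). -/

/-! ### Exponential contraction principle for sign averages -/

/-- Weak majorization for the increasing convex function exp. Once y is raised until the sums agree,
the products of the exponentials agree too, and the claim becomes (e^X - e^x)(e^x - e^Y) ≥ 0. -/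
lemma exp_add_exp_le_of_majorized {x y X Y : ℝ} (hsum : x + y ≤ X + Y)
    (hx : x ≤ max X Y) (hy : y ≤ max X Y) :
    Real.exp x + Real.exp y ≤ Real.exp X + Real.exp Y := by
  wlog hXY : Y ≤ X generalizing X Y
  · rw [add_comm (Real.exp X)]
    exact this (by linarith) (by rwa [max_comm]) (by rwa [max_comm]) (le_of_not_ge hXY)
  rw [max_eq_left hXY] at hx hy
  wlog hxy : y ≤ x generalizing x y
  · rw [add_comm (Real.exp x)]
    exact this (by linarith) hy hx (le_of_not_ge hxy)
  rcases le_total y Y with h | h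
  · exact add_le_add (Real.exp_le_exp.2 hx) (Real.exp_le_exp.2 h)
  have h1 : Real.exp y ≤ Real.exp (X + Y - x) := Real.exp_le_exp.2 (by linarith)
  have h2 : Real.exp (X + Y - x) * Real.exp x = Real.exp X * Real.exp Y := by
    rw [← Real.exp_add, ← Real.exp_add]; congr 1; ring
  have h3 : Real.exp x ≤ Real.exp X := Real.exp_le_exp.2 hx
  have h4 : Real.exp Y ≤ Real.exp x := Real.exp_le_exp.2 (h.trans hxy)
  have h5 := Real.exp_pos x
  have h6 : (Real.exp x + Real.exp (X + Y - x)) * Real.exp x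
      ≤ (Real.exp X + Real.exp Y) * Real.exp x := by
    nlinarith [mul_nonneg (sub_nonneg.2 h3) (sub_nonneg.2 h4)]
  linarith [le_of_mul_le_mul_right h6 h5]

/-- `∑_ε sup_t exp (f t ε)`, the sum running over all sign vectors of length `n`. -/
noncomputable def signExpSum {T : Type*} {n : ℕ} (f : T → (Fin n → ℤˣ) → ℝ) : ℝ≥0∞ :=
  ∑ ε, ⨆ t, ENNReal.ofReal (Real.exp (f t ε))

lemma signExpSum_mono {T : Type*} {n : ℕ} {f g : T → (Fin n → ℤˣ) → ℝ}
    (h : ∀ t ε, f t ε ≤ g t ε) : signExpSum f ≤ signExpSum g :=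
  Finset.sum_le_sum fun ε _ => iSup_mono fun t =>
    ENNReal.ofReal_le_ofReal (Real.exp_le_exp.2 (h t ε))

lemma signExpSum_le_of_forall_exists {T T' : Type*} {n : ℕ} {f : T → (Fin n → ℤˣ) → ℝ}
    {g : T' → (Fin n → ℤˣ) → ℝ} (h : ∀ t ε, ∃ t', f t ε ≤ g t' ε) :
    signExpSum f ≤ signExpSum g :=
  Finset.sum_le_sum fun ε _ => iSup_le fun t => by
    obtain ⟨t', ht'⟩ := h t ε
    exact (ENNReal.ofReal_le_ofReal (Real.exp_le_exp.2 ht')).trans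
      (le_iSup (fun t' => ENNReal.ofReal (Real.exp (g t' ε))) t')

lemma signExpSum_neg {T : Type*} {n : ℕ} (f : T → (Fin n → ℤˣ) → ℝ) :
    signExpSum (fun t ε => f t (-ε)) = signExpSum f :=
  Equiv.sum_comp (Equiv.neg (Fin n → ℤˣ)) fun ε => ⨆ t, ENNReal.ofReal (Real.exp (f t ε))

/-- exp |f| is exp f or exp (-f), and for a process odd in the signs the second is the first at -ε,
which has the same sum over all ε. This is the factor 2 paid for each layer. -/
lemma signExpSum_abs_le {T : Type*} {n : ℕ} (f : T → (Fin n → ℤˣ) → ℝ)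
    (hf : ∀ t ε, f t (-ε) = - f t ε) :
    signExpSum (fun t ε => |f t ε|) ≤ 2 * signExpSum f := by
  have h : signExpSum (fun t ε => |f t ε|)
      ≤ signExpSum f + signExpSum (fun t ε => f t (-ε)) := by
    unfold signExpSum
    rw [← Finset.sum_add_distrib]
    refine Finset.sum_le_sum fun ε _ => iSup_le fun t => ?_
    beta_reduce
    rcases abs_cases (f t ε) with ⟨h, -⟩ | ⟨h, -⟩
    · rw [h]
      exact (le_iSup (fun t => ENNReal.ofReal (Real.exp (f t ε))) t).trans le_self_add
    · rw [h, ← hf]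
      exact (le_iSup (fun t => ENNReal.ofReal (Real.exp (f t (-ε)))) t).trans le_add_self
  rwa [signExpSum_neg, ← two_mul] at h

lemma sum_signs_succ {M : Type*} [AddCommMonoid M] {n : ℕ} (F : (Fin (n + 1) → ℤˣ) → M) :
    ∑ ε, F ε = (∑ ε : Fin n → ℤˣ, F (Fin.cons 1 ε)) + ∑ ε : Fin n → ℤˣ, F (Fin.cons (-1) ε) := by
  rw [← (Fin.consEquiv fun _ : Fin (n + 1) => ℤˣ).sum_comp, Fintype.sum_prod_type, UnitsInt.univ,
    Finset.sum_pair (by decide)]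
  rfl

/-- Contraction principle for one sign. -/
lemma iSup_exp_add_contraction {T : Type*} (a h b : T → ℝ)
    (hlip : ∀ t s, |h t - h s| ≤ |b t - b s|) (h0 : ∀ t, |h t| ≤ |b t|) :
    (⨆ t, ENNReal.ofReal (Real.exp (a t + h t))) + (⨆ t, ENNReal.ofReal (Real.exp (a t - h t)))
      ≤ (⨆ t, ENNReal.ofReal (Real.exp (a t + b t)))
        + ⨆ t, ENNReal.ofReal (Real.exp (a t - b t)) := by
  rcases isEmpty_or_nonempty T with hT | hT
  · simp
  refine ENNReal.iSup_add_iSup_le fun t s => ?_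
  have hX : ENNReal.ofReal (Real.exp (max (a t + b t) (a s + b s)))
      ≤ ⨆ t, ENNReal.ofReal (Real.exp (a t + b t)) := by
    rcases max_choice (a t + b t) (a s + b s) with h | h <;> rw [h]
    · exact le_iSup (fun t => ENNReal.ofReal (Real.exp (a t + b t))) t
    · exact le_iSup (fun t => ENNReal.ofReal (Real.exp (a t + b t))) s
  have hY : ENNReal.ofReal (Real.exp (max (a t - b t) (a s - b s)))
      ≤ ⨆ t, ENNReal.ofReal (Real.exp (a t - b t)) := by
    rcases max_choice (a t - b t) (a s - b s) with h | h <;> rw [h]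
    · exact le_iSup (fun t => ENNReal.ofReal (Real.exp (a t - b t))) t
    · exact le_iSup (fun t => ENNReal.ofReal (Real.exp (a t - b t))) s
  refine le_trans ?_ (add_le_add hX hY)
  rw [← ENNReal.ofReal_add (Real.exp_pos _).le (Real.exp_pos _).le,
    ← ENNReal.ofReal_add (Real.exp_pos _).le (Real.exp_pos _).le]
  -- The maxima over {t, s} majorize the pair (a t + h t, a s - h s): the sum is controlled by the
  -- Lipschitz comparison, each single term by |h| ≤ |b|.
  refine ENNReal.ofReal_le_ofReal (exp_add_exp_le_of_majorized ?_ ?_ ?_)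
  · have h1 := (le_abs_self _).trans (hlip t s)
    have := le_max_left (a t + b t) (a s + b s)
    have := le_max_right (a t + b t) (a s + b s)
    have := le_max_left (a t - b t) (a s - b s)
    have := le_max_right (a t - b t) (a s - b s)
    rcases abs_cases (b t - b s) with ⟨h, -⟩ | ⟨h, -⟩ <;> linarith
  · have h1 := (le_abs_self _).trans (h0 t)
    rcases abs_cases (b t) with ⟨h, -⟩ | ⟨h, -⟩
    · exact le_max_of_le_left (le_max_of_le_left (by linarith))
    · exact le_max_of_le_right (le_max_of_le_left (by linarith))
  · have h1 := (neg_le_abs _).trans (h0 s)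
    rcases abs_cases (b s) with ⟨h, -⟩ | ⟨h, -⟩
    · exact le_max_of_le_left (le_max_of_le_right (by linarith))
    · exact le_max_of_le_right (le_max_of_le_right (by linarith))

/-- Contraction principle for the exponential moments of a Rademacher process. -/
lemma signExpSum_contraction {T : Type*} {n : ℕ} (a : T → ℝ) (h b : T → Fin n → ℝ)
    (hlip : ∀ t s i, |h t i - h s i| ≤ |b t i - b s i|) (h0 : ∀ t i, |h t i| ≤ |b t i|) :
    signExpSum (fun t (ε : Fin n → ℤˣ) => a t + ∑ i, ((ε i : ℤ) : ℝ) * h t i)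
      ≤ signExpSum (fun t (ε : Fin n → ℤˣ) => a t + ∑ i, ((ε i : ℤ) : ℝ) * b t i) := by
  induction n generalizing a with
  | zero => simp
  | succ n ih =>
    have key (c : T → ℝ) :
        (signExpSum fun t (ε : Fin n → ℤˣ) => c t + ∑ i, ((ε i : ℤ) : ℝ) * h t i.succ)
          ≤ signExpSum fun t (ε : Fin n → ℤˣ) => c t + ∑ i, ((ε i : ℤ) : ℝ) * b t i.succ :=
      ih c (fun t i => h t i.succ) (fun t i => b t i.succ) (fun t s i => hlip t s i.succ)
        fun t i => h0 t i.succ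
    -- The first sign is contracted last: conditioned on its value, ±b t 0 is absorbed into the free
    -- term a of the induction hypothesis.
    have key' := add_le_add (key fun t => a t + b t 0) (key fun t => a t - b t 0)
    unfold signExpSum at key' ⊢
    rw [sum_signs_succ, sum_signs_succ]
    simp only [Fin.sum_univ_succ, Fin.cons_zero, Fin.cons_succ, Units.val_one, Units.val_neg,
      Int.cast_one, Int.cast_neg, one_mul, neg_mul, ← add_assoc, ← sub_eq_add_neg]
    refine le_trans ?_ key'
    rw [← Finset.sum_add_distrib, ← Finset.sum_add_distrib]
    refine Finset.sum_le_sum fun ε _ => ?_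
    have := iSup_exp_add_contraction (fun t => a t + ∑ i, ((ε i : ℤ) : ℝ) * h t i.succ)
      (fun t => h t 0) (fun t => b t 0) (fun t s => hlip t s 0) fun t => h0 t 0
    simpa only [add_right_comm, sub_add_eq_add_sub] using this

/-! ### Exponential moments of Rademacher sums in an inner product space -/

/-- s and t are convex combinations of S and T with interchanged weights, so adding the two
convexity inequalities for the power gives the bound. -/
lemma pow_add_pow_le_of_majorized {s t S T : ℝ} (hs : T ≤ s) (hs' : s ≤ S) (hT : 0 ≤ T)
    (hsum : s + t = S + T) (n : ℕ) : s ^ n + t ^ n ≤ S ^ n + T ^ n := by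
  obtain rfl : t = S + T - s := by linarith
  rcases (hs.trans hs').eq_or_lt with h | h
  · rw [show s = S by linarith, h, add_sub_cancel_right]
  have hd : 0 < S - T := sub_pos.2 h
  have hsum1 : (s - T) / (S - T) + (S - s) / (S - T) = 1 := by field_simp; ring
  have h1 : 0 ≤ (s - T) / (S - T) := div_nonneg (by linarith) hd.le
  have h2 : 0 ≤ (S - s) / (S - T) := div_nonneg (by linarith) hd.le
  have hS : S ∈ Set.Ici (0 : ℝ) := hT.trans h.le
  have hc := (convexOn_pow (𝕜 := ℝ) n).2 hS hT h1 h2 hsum1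
  have hc' := (convexOn_pow (𝕜 := ℝ) n).2 hT hS h1 h2 hsum1
  simp only [smul_eq_mul] at hc hc'
  rw [show (s - T) / (S - T) * S + (S - s) / (S - T) * T = s by field_simp; ring] at hc
  rw [show (s - T) / (S - T) * T + (S - s) / (S - T) * S = S + T - s by field_simp; ring] at hc'
  refine (add_le_add hc hc').trans (le_of_eq ?_)
  linear_combination (S ^ n + T ^ n) * hsum1

/-- cosh is a power series with nonnegative coefficients in the squared norm. The squares of ‖x ± y‖
have the same sum as those of ‖x‖ ± ‖y‖ and, by Cauchy–Schwarz, lie between them, so the comparison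
holds term by term. -/
lemma cosh_norm_add_add_cosh_norm_sub_le {E : Type*} [NormedAddCommGroup E]
    [InnerProductSpace ℝ E] (x y : E) :
    Real.cosh ‖x + y‖ + Real.cosh ‖x - y‖ ≤ 2 * (Real.cosh ‖x‖ * Real.cosh ‖y‖) := by
  have h1 : 2 * (Real.cosh ‖x‖ * Real.cosh ‖y‖)
      = Real.cosh (‖x‖ + ‖y‖) + Real.cosh (‖x‖ - ‖y‖) := by
    rw [Real.cosh_add, Real.cosh_sub]; ring
  rw [h1]
  refine hasSum_le (fun n => ?_) ((Real.hasSum_cosh _).add (Real.hasSum_cosh _))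
    ((Real.hasSum_cosh _).add (Real.hasSum_cosh _))
  rw [← add_div, ← add_div]
  refine div_le_div_of_nonneg_right ?_ (by positivity)
  rw [pow_mul, pow_mul, pow_mul, pow_mul]
  have hi := abs_le.1 (abs_real_inner_le_norm x y)
  have hp := norm_add_sq_real x y
  have hm := norm_sub_sq_real x y
  exact pow_add_pow_le_of_majorized (by nlinarith) (by nlinarith) (sq_nonneg _) (by nlinarith) n

lemma sum_signs_cosh_norm_le {E : Type*} [NormedAddCommGroup E] [InnerProductSpace ℝ E] {n : ℕ}
    (v : E) (x : Fin n → E) :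
    ∑ ε : Fin n → ℤˣ, Real.cosh ‖v + ∑ i, ((ε i : ℤ) : ℝ) • x i‖
      ≤ 2 ^ n * (Real.cosh ‖v‖ * ∏ i, Real.cosh ‖x i‖) := by
  induction n generalizing v with
  | zero => simp
  | succ n ih =>
    rw [sum_signs_succ]
    simp only [Fin.sum_univ_succ, Fin.cons_zero, Fin.cons_succ, Units.val_one, Units.val_neg,
      Int.cast_one, Int.cast_neg, one_smul, neg_smul, ← add_assoc, Fin.prod_univ_succ]
    refine (add_le_add (ih (v + x 0) _) (ih (v + -x 0) _)).trans ?_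
    rw [← mul_add, ← add_mul, ← sub_eq_add_neg, pow_succ, mul_assoc]
    refine mul_le_mul_of_nonneg_left ?_ (by positivity)
    refine (mul_le_mul_of_nonneg_right (cosh_norm_add_add_cosh_norm_sub_le v (x 0))
      (Finset.prod_nonneg fun i _ => (Real.cosh_pos _).le)).trans (le_of_eq ?_)
    ring

/-- Passing through exp ≤ 2 cosh makes the bound dimension-free, since cosh of the norm factorizes
over independent signs; each factor is then sub-Gaussian by cosh r ≤ exp(r²/2). -/
lemma sum_signs_exp_norm_le {E : Type*} [NormedAddCommGroup E] [InnerProductSpace ℝ E] {n : ℕ}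
    (x : Fin n → E) (B : ℝ) (hx : ∀ i, ‖x i‖ ≤ B) :
    ∑ ε : Fin n → ℤˣ, Real.exp ‖∑ i, ((ε i : ℤ) : ℝ) • x i‖
      ≤ 2 * 2 ^ n * Real.exp (n * B ^ 2 / 2) := by
  have h1 := sum_signs_cosh_norm_le 0 x
  simp only [zero_add, norm_zero, Real.cosh_zero, one_mul] at h1
  have h2 : ∏ i, Real.cosh ‖x i‖ ≤ Real.exp (n * B ^ 2 / 2) := by
    calc ∏ i, Real.cosh ‖x i‖ ≤ ∏ _i : Fin n, Real.exp (B ^ 2 / 2) := by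
          refine Finset.prod_le_prod (fun i _ => (Real.cosh_pos _).le) fun i _ => ?_
          refine (Real.cosh_le_exp_half_sq _).trans (Real.exp_le_exp.2 ?_)
          have := pow_le_pow_left₀ (norm_nonneg (x i)) (hx i) 2
          linarith
      _ = Real.exp (n * B ^ 2 / 2) := by
          rw [Finset.prod_const, ← Real.exp_nat_mul, Finset.card_univ, Fintype.card_fin, mul_div_assoc]
  calc ∑ ε : Fin n → ℤˣ, Real.exp ‖∑ i, ((ε i : ℤ) : ℝ) • x i‖
      ≤ ∑ ε : Fin n → ℤˣ, 2 * Real.cosh ‖∑ i, ((ε i : ℤ) : ℝ) • x i‖ := by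
        refine Finset.sum_le_sum fun ε _ => ?_
        rw [Real.cosh_eq]
        linarith [Real.exp_pos (-‖∑ i, ((ε i : ℤ) : ℝ) • x i‖)]
    _ ≤ 2 * (2 ^ n * Real.exp (n * B ^ 2 / 2)) := by
        rw [← Finset.mul_sum]
        gcongr
        exact h1.trans (by gcongr)
    _ = _ := by ring

/-! ### Peeling off the layers of a network -/

lemma frobNorm_nonneg {a b : ℕ} (A : Matrix (Fin a) (Fin b) ℝ) : 0 ≤ frobNorm A := by
  let _ := Matrix.frobeniusNormedAddCommGroup (m := Fin a) (n := Fin b) (α := ℝ)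
  exact norm_nonneg A

lemma frobNorm_zero {a b : ℕ} : frobNorm (0 : Matrix (Fin a) (Fin b) ℝ) = 0 := by
  let _ := Matrix.frobeniusNormedAddCommGroup (m := Fin a) (n := Fin b) (α := ℝ)
  exact norm_zero

lemma frobNorm_sq {a b : ℕ} (A : Matrix (Fin a) (Fin b) ℝ) :
    frobNorm A ^ 2 = ∑ i, ‖WithLp.toLp 2 (A i)‖ ^ 2 := by
  have h : frobNorm A = (∑ i, ∑ j, ‖A i j‖ ^ (2 : ℝ)) ^ (1 / 2 : ℝ) := Matrix.frobenius_norm_def A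
  rw [h, ← Real.sqrt_eq_rpow, Real.sq_sqrt (by positivity)]
  simp [EuclideanSpace.norm_sq_eq]

lemma linLayer_apply {a b : ℕ} (A : Matrix (Fin b) (Fin a) ℝ) (x : EuclideanSpace ℝ (Fin a))
    (j : Fin b) : linLayer A x j = inner ℝ (WithLp.toLp 2 (A j)) x := by
  simp [linLayer, Matrix.mulVec, dotProduct, PiLp.inner_apply, mul_comm]

lemma linLayer_eq_toLpLin {a b : ℕ} (A : Matrix (Fin b) (Fin a) ℝ) (x : EuclideanSpace ℝ (Fin a)) :
    linLayer A x = Matrix.toEuclideanLin A x := rfl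

lemma norm_linLayer_le {a b : ℕ} (A : Matrix (Fin b) (Fin a) ℝ) (x : EuclideanSpace ℝ (Fin a)) :
    ‖linLayer A x‖ ≤ frobNorm A * ‖x‖ := by
  refine le_of_sq_le_sq ?_ (mul_nonneg (frobNorm_nonneg A) (norm_nonneg x))
  rw [mul_pow, frobNorm_sq, EuclideanSpace.norm_sq_eq, Finset.sum_mul]
  refine Finset.sum_le_sum fun j _ => ?_
  rw [linLayer_apply, ← mul_pow]
  exact pow_le_pow_left₀ (norm_nonneg _) (norm_inner_le_norm _ _) 2

lemma linLayer_sum_smul {a b n : ℕ} (A : Matrix (Fin b) (Fin a) ℝ) (c : Fin n → ℝ)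
    (x : Fin n → EuclideanSpace ℝ (Fin a)) :
    linLayer A (∑ i, c i • x i) = ∑ i, c i • linLayer A (x i) := by
  simp only [linLayer_eq_toLpLin, map_sum, map_smul]

lemma norm_entrywise_le {b : ℕ} {ρ : ℝ → ℝ} {R : ℝ≥0} (hρ : LipschitzWith R ρ) (h0 : ρ 0 = 0)
    (x : EuclideanSpace ℝ (Fin b)) : ‖entrywise ρ x‖ ≤ R * ‖x‖ := by
  refine le_of_sq_le_sq ?_ (by positivity)
  rw [mul_pow, EuclideanSpace.norm_sq_eq, EuclideanSpace.norm_sq_eq, Finset.mul_sum]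
  refine Finset.sum_le_sum fun j _ => ?_
  rw [← mul_pow]
  have := hρ.dist_le_mul (x j) 0
  rw [h0, dist_zero_right, dist_zero_right] at this
  exact pow_le_pow_left₀ (norm_nonneg _) this 2

/-- A positively homogeneous layer is dominated by a single neuron in the unit ball. -/
lemma exists_neuron_dominating {n a b : ℕ} {ρ : ℝ → ℝ}
    (hpos : ∀ c : ℝ, 0 ≤ c → ∀ p : ℝ, ρ (c * p) = c * ρ p) {M : ℝ≥0}
    (W : Matrix (Fin b) (Fin a) ℝ) (hW : frobNorm W ≤ M)
    (v : Fin n → EuclideanSpace ℝ (Fin a)) (c : Fin n → ℝ) :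
    ∃ u : Metric.closedBall (0 : EuclideanSpace ℝ (Fin a)) 1,
      ‖∑ i, c i • entrywise ρ (linLayer W (v i))‖ ≤ M * |∑ i, c i * ρ (inner ℝ u.1 (v i))| := by
  set w : Fin b → EuclideanSpace ℝ (Fin a) := fun j => WithLp.toLp 2 (W j) with hw
  set u : Fin b → EuclideanSpace ℝ (Fin a) := fun j => ‖w j‖⁻¹ • w j with hu
  set s : Fin b → ℝ := fun j => ∑ i, c i * ρ (inner ℝ (u j) (v i)) with hs
  have hu1 (j : Fin b) : u j ∈ Metric.closedBall (0 : EuclideanSpace ℝ (Fin a)) 1 := by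
    rw [mem_closedBall_zero_iff, hu, norm_smul, norm_inv, norm_norm]
    exact inv_mul_le_one
  -- A zero row also fits: its normalization is 0, as the inverse of 0 is 0, and it still lies in
  -- the unit ball.
  have hwu (j : Fin b) : w j = ‖w j‖ • u j := by
    rcases eq_or_ne (w j) 0 with h | h
    · simp [h]
    · rw [hu, smul_smul, mul_inv_cancel₀ (norm_ne_zero_iff.2 h), one_smul]
  -- Homogeneity extracts the row norm from neuron j. The squared norm is then a sum weighted by
  -- squared row norms, which add up to the squared Frobenius norm, and the largest |s j| comes out
  -- of it.
  have hy (j : Fin b) : (∑ i, c i • entrywise ρ (linLayer W (v i))) j = ‖w j‖ * s j := by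
    rw [WithLp.ofLp_sum, Finset.sum_apply, hs, Finset.mul_sum]
    refine Finset.sum_congr rfl fun i _ => ?_
    have h : linLayer W (v i) j = ‖w j‖ * inner ℝ (u j) (v i) := by
      rw [linLayer_apply, ← real_inner_smul_left, ← hwu j]
    change c i * ρ (linLayer W (v i) j) = _
    rw [h, hpos _ (norm_nonneg _)]
    ring
  rcases Nat.eq_zero_or_pos b with hb | hb
  · subst hb
    refine ⟨⟨0, by simp⟩, ?_⟩
    rw [Subsingleton.elim (∑ i, c i • entrywise ρ (linLayer W (v i))) 0, norm_zero]
    positivity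
  · have : Nonempty (Fin b) := ⟨⟨0, hb⟩⟩
    obtain ⟨j, -, hj⟩ := Finset.exists_max_image Finset.univ (fun j => |s j|)
      Finset.univ_nonempty
    refine ⟨⟨u j, hu1 j⟩, le_of_sq_le_sq ?_ (by positivity)⟩
    calc ‖∑ i, c i • entrywise ρ (linLayer W (v i))‖ ^ 2
        = ∑ j, ‖w j‖ ^ 2 * |s j| ^ 2 := by
          rw [EuclideanSpace.norm_sq_eq]
          exact Finset.sum_congr rfl fun j _ => by
            rw [hy, Real.norm_eq_abs, abs_mul, abs_norm, mul_pow]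
      _ ≤ ∑ j', ‖w j'‖ ^ 2 * |s j| ^ 2 := by
          refine Finset.sum_le_sum fun j' hj' => mul_le_mul_of_nonneg_left ?_ (sq_nonneg _)
          exact pow_le_pow_left₀ (abs_nonneg _) (hj j' hj') 2
      _ = frobNorm W ^ 2 * |s j| ^ 2 := by rw [← Finset.sum_mul, frobNorm_sq]
      _ ≤ (M * |s j|) ^ 2 := by
          rw [mul_pow]
          have := frobNorm_nonneg W
          gcongr

lemma apply_zero_of_posHom {ρ : ℝ → ℝ} (hpos : ∀ c : ℝ, 0 ≤ c → ∀ p : ℝ, ρ (c * p) = c * ρ p) :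
    ρ 0 = 0 := by
  simpa using hpos 0 le_rfl 0

/-- Removal of a hidden layer from the exponential moment of a Rademacher process. -/
lemma signExpSum_layer_le {T : Type*} {n a b : ℕ} {ρ : ℝ → ℝ} {R M : ℝ≥0}
    (hρ : LipschitzWith R ρ) (hpos : ∀ c : ℝ, 0 ≤ c → ∀ p : ℝ, ρ (c * p) = c * ρ p)
    (W : T → Matrix (Fin b) (Fin a) ℝ) (hW : ∀ t, frobNorm (W t) ≤ M)
    (v : T → Fin n → EuclideanSpace ℝ (Fin a)) {c : ℝ} (hc : 0 ≤ c) :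
    signExpSum (fun t (ε : Fin n → ℤˣ) =>
        c * ‖∑ i, ((ε i : ℤ) : ℝ) • entrywise ρ (linLayer (W t) (v t i))‖)
      ≤ 2 * signExpSum (fun t (ε : Fin n → ℤˣ) =>
        c * (M * R) * ‖∑ i, ((ε i : ℤ) : ℝ) • v t i‖) := by
  let U := Metric.closedBall (0 : EuclideanSpace ℝ (Fin a)) 1
  have hcM : 0 ≤ c * M := by positivity
  have hcMR : 0 ≤ c * (M * R) := by positivity
  have h1 : signExpSum (fun t (ε : Fin n → ℤˣ) =>
        c * ‖∑ i, ((ε i : ℤ) : ℝ) • entrywise ρ (linLayer (W t) (v t i))‖)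
      ≤ signExpSum (fun (q : T × U) (ε : Fin n → ℤˣ) =>
        |∑ i, ((ε i : ℤ) : ℝ) * (c * M * ρ (inner ℝ q.2.1 (v q.1 i)))|) := by
    -- The dominating neuron depends on ε. This is harmless because the supremum stands inside the
    -- sum over sign vectors, so the index set may be enlarged by the unit ball.
    refine signExpSum_le_of_forall_exists fun t ε => ?_
    obtain ⟨u, hu⟩ := exists_neuron_dominating hpos (W t) (hW t) (v t) fun i => ((ε i : ℤ) : ℝ)
    refine ⟨(t, u), (mul_le_mul_of_nonneg_left hu hc).trans (le_of_eq ?_)⟩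
    rw [← mul_assoc, ← abs_of_nonneg hcM, ← abs_mul, Finset.mul_sum, abs_of_nonneg hcM]
    congr 1
    exact Finset.sum_congr rfl fun i _ => by ring
  have h2 := signExpSum_abs_le (fun (q : T × U) (ε : Fin n → ℤˣ) =>
    ∑ i, ((ε i : ℤ) : ℝ) * (c * M * ρ (inner ℝ q.2.1 (v q.1 i)))) (by simp)
  have h3 := signExpSum_contraction (T := T × U) (n := n) (fun _ => 0)
    (fun q i => c * M * ρ (inner ℝ q.2.1 (v q.1 i)))
    (fun q i => c * (M * R) * inner ℝ q.2.1 (v q.1 i))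
    (fun q q' i => by
      rw [← mul_sub, ← mul_sub, abs_mul, abs_of_nonneg hcM, abs_mul, abs_of_nonneg hcMR,
        ← mul_assoc c, mul_assoc (c * (M : ℝ))]
      exact mul_le_mul_of_nonneg_left (hρ.dist_le_mul _ _) hcM)
    (fun q i => by
      rw [abs_mul, abs_of_nonneg hcM, abs_mul, abs_of_nonneg hcMR, ← mul_assoc c,
        mul_assoc (c * (M : ℝ))]
      have := hρ.dist_le_mul (inner ℝ q.2.1 (v q.1 i)) 0
      rw [apply_zero_of_posHom hpos, dist_zero_right, dist_zero_right] at this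
      exact mul_le_mul_of_nonneg_left this hcM)
  simp only [zero_add] at h3
  have h4 : signExpSum (fun (q : T × U) (ε : Fin n → ℤˣ) =>
        ∑ i, ((ε i : ℤ) : ℝ) * (c * (M * R) * inner ℝ q.2.1 (v q.1 i)))
      ≤ signExpSum (fun t (ε : Fin n → ℤˣ) => c * (M * R) * ‖∑ i, ((ε i : ℤ) : ℝ) • v t i‖) := by
    refine signExpSum_le_of_forall_exists fun q ε => ⟨q.1, ?_⟩
    have : ∑ i, ((ε i : ℤ) : ℝ) * (c * (M * R) * inner ℝ q.2.1 (v q.1 i))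
        = c * (M * R) * inner ℝ q.2.1 (∑ i, ((ε i : ℤ) : ℝ) • v q.1 i) := by
      rw [inner_sum, Finset.mul_sum]
      exact Finset.sum_congr rfl fun i _ => by rw [real_inner_smul_right]; ring
    rw [this]
    refine mul_le_mul_of_nonneg_left ?_ (by positivity)
    refine (real_inner_le_norm _ _).trans (mul_le_of_le_one_left (norm_nonneg _) ?_)
    exact mem_closedBall_zero_iff.1 q.2.2
  exact h1.trans (h2.trans (mul_le_mul_right (h3.trans h4) 2))

/-- Product of the norm bounds of the first `i` hidden layers. -/
noncomputable def layerProd {K : ℕ} (M R : Fin K → ℝ≥0) (i : ℕ) : ℝ :=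
  ∏ j ∈ Finset.range i, if h : j < K then (M ⟨j, h⟩ * R ⟨j, h⟩ : ℝ) else 1

lemma layerProd_nonneg {K : ℕ} (M R : Fin K → ℝ≥0) (i : ℕ) : 0 ≤ layerProd M R i :=
  Finset.prod_nonneg fun j _ => by split_ifs <;> positivity

lemma layerProd_succ {K : ℕ} (M R : Fin K → ℝ≥0) (i : ℕ) (h : i < K) :
    layerProd M R (i + 1) = layerProd M R i * (M ⟨i, h⟩ * R ⟨i, h⟩) := by
  rw [layerProd, Finset.prod_range_succ, dif_pos h, layerProd]

lemma layerProd_self {K : ℕ} (M R : Fin K → ℝ≥0) : layerProd M R K = ∏ i, (M i * R i : ℝ) := by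
  rw [layerProd, Finset.prod_range]
  simp

lemma norm_hidden_le {K : ℕ} {a : ℕ → ℕ} {ρ : Fin K → ℝ → ℝ} {M R : Fin K → ℝ≥0}
    (hρ : ∀ i, LipschitzWith (R i) (ρ i))
    (hpos : ∀ i, ∀ c : ℝ, 0 ≤ c → ∀ p : ℝ, ρ i (c * p) = c * ρ i p)
    (W : ∀ i : Fin K, Matrix (Fin (a (i + 1))) (Fin (a i)) ℝ) (hW : ∀ i, frobNorm (W i) ≤ M i)
    (x : EuclideanSpace ℝ (Fin (a 0))) (i : ℕ) (hi : i ≤ K) :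
    ‖hidden a ρ W x i hi‖ ≤ layerProd M R i * ‖x‖ := by
  induction i with
  | zero => simp [hidden, layerProd]
  | succ i ih =>
    rw [hidden, layerProd_succ M R i hi]
    calc _ ≤ (R ⟨i, hi⟩ : ℝ) * ‖linLayer (W ⟨i, hi⟩) (hidden a ρ W x i _)‖ :=
          norm_entrywise_le (hρ _) (apply_zero_of_posHom (hpos _)) _
      _ ≤ R ⟨i, hi⟩ * (M ⟨i, hi⟩ * (layerProd M R i * ‖x‖)) := by
          gcongr
          exact (norm_linLayer_le _ _).trans (mul_le_mul (hW _) (ih _) (norm_nonneg _) (by positivity))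
      _ = _ := by ring

/-- Removal of all hidden layers of a network. -/
lemma signExpSum_hidden_le {T : Type*} {n K : ℕ} {a : ℕ → ℕ} {ρ : Fin K → ℝ → ℝ}
    {M R : Fin K → ℝ≥0} (hρ : ∀ i, LipschitzWith (R i) (ρ i))
    (hpos : ∀ i, ∀ c : ℝ, 0 ≤ c → ∀ p : ℝ, ρ i (c * p) = c * ρ i p)
    (W : T → ∀ i : Fin K, Matrix (Fin (a (i + 1))) (Fin (a i)) ℝ)
    (hW : ∀ t i, frobNorm (W t i) ≤ M i)
    (x : T → Fin n → EuclideanSpace ℝ (Fin (a 0))) (i : ℕ) (hi : i ≤ K) {c : ℝ} (hc : 0 ≤ c) :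
    signExpSum (fun t (ε : Fin n → ℤˣ) =>
        c * ‖∑ j, ((ε j : ℤ) : ℝ) • hidden a ρ (W t) (x t j) i hi‖)
      ≤ 2 ^ i * signExpSum (fun t (ε : Fin n → ℤˣ) =>
        c * layerProd M R i * ‖∑ j, ((ε j : ℤ) : ℝ) • x t j‖) := by
  -- The factor c varies because each removed layer multiplies it by its norm bound.
  induction i generalizing c with
  | zero => simp [hidden, layerProd]
  | succ i ih =>
    simp only [hidden]
    refine (signExpSum_layer_le (hρ _) (hpos _) (fun t => W t ⟨i, hi⟩) (fun t => hW t _) _ hc).trans ?_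
    rw [pow_succ', mul_assoc]
    refine mul_le_mul_right ((ih (Nat.le_of_succ_le hi) (by positivity)).trans (le_of_eq ?_)) 2
    rw [layerProd_succ M R i hi]
    congr 2
    funext t ε
    ring

/-! ### From exponential moments to expectations -/

/-- Returns from the extended supremum to the real one. An infinite right side makes the claim
trivial, which covers the default value 0 of an unbounded real supremum; otherwise logarithms apply.
-/
lemma exp_iSup_le_iSup_exp {T : Type*} [Nonempty T] (s : T → ℝ) {c : ℝ} (hc : 0 < c) :
    ENNReal.ofReal (Real.exp (c * ⨆ t, s t)) ≤ ⨆ t, ENNReal.ofReal (Real.exp (c * s t)) := by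
  rcases eq_or_ne (⨆ t, ENNReal.ofReal (Real.exp (c * s t))) ⊤ with h | h
  · rw [h]; exact le_top
  set r := ⨆ t, ENNReal.ofReal (Real.exp (c * s t)) with hr
  have hle (t : T) : Real.exp (c * s t) ≤ r.toReal :=
    (ENNReal.ofReal_le_iff_le_toReal h).1
      (le_iSup (fun t => ENNReal.ofReal (Real.exp (c * s t))) t)
  have hpos : 0 < r.toReal := (Real.exp_pos _).trans_le (hle (Classical.arbitrary T))
  rw [ENNReal.ofReal_le_iff_le_toReal h, ← Real.le_log_iff_exp_le hpos, mul_comm,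
    ← le_div_iff₀ hc]
  refine ciSup_le fun t => ?_
  rw [le_div_iff₀ hc, mul_comm, Real.le_log_iff_exp_le hpos]
  exact hle t

/-- The optimization over c in the Chernoff argument: c = X / b refutes a larger X, and when b = 0
any c with c * X > a does. -/
lemma le_sqrt_of_forall_mul_le {X a b : ℝ} (ha : 0 ≤ a) (hb : 0 ≤ b)
    (h : ∀ c : ℝ, 0 < c → c * X ≤ a + c ^ 2 * b / 2) : X ≤ √(2 * a * b) := by
  by_contra! hX
  have hX0 : 0 < X := (Real.sqrt_nonneg _).trans_lt hX
  have hX2 : 2 * a * b < X ^ 2 := (Real.sqrt_lt' hX0).1 hX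
  rcases hb.eq_or_lt with hb | hb
  · subst hb
    have := h ((a + 1) / X) (by positivity)
    rw [div_mul_cancel₀ _ hX0.ne'] at this
    linarith
  · have := h (X / b) (by positivity)
    have h2 : X / b * X = X ^ 2 / b := by ring
    have h3 : (X / b) ^ 2 * b / 2 = X ^ 2 / b / 2 := by field_simp
    rw [h2, h3] at this
    have h4 : 2 * a < X ^ 2 / b := by rwa [lt_div_iff₀ hb]
    linarith

/-- From a sub-Gaussian bound of the exponential moments to a bound of the expectation. -/
lemma signAverage_le {T : Type*} [Nonempty T] {n : ℕ} (hn : 0 < n) (k : ℕ) {q : ℝ} (hq : 0 ≤ q)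
    (f : T → Fin n → ℝ)
    (h : ∀ c : ℝ, 0 ≤ c →
      signExpSum (fun t (ε : Fin n → ℤˣ) => c * |∑ j, ((ε j : ℤ) : ℝ) * f t j|)
        ≤ ENNReal.ofReal (2 ^ (k + 2) * 2 ^ n * Real.exp (n * (c * q) ^ 2 / 2))) :
    (1 / (2 : ℝ) ^ n) * ∑ ε : Fin n → ℤˣ, ⨆ t, |(1 / (n : ℝ)) * ∑ j, ((ε j : ℤ) : ℝ) * f t j|
      ≤ q * √(3 * ((k : ℝ) + 1)) / √n := by
  have hn' : (0 : ℝ) < n := Nat.cast_pos.2 hn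
  have hcard : (Fintype.card (Fin n → ℤˣ) : ℝ) = 2 ^ n := by simp
  set s : (Fin n → ℤˣ) → ℝ := fun ε => ⨆ t, |∑ j, ((ε j : ℤ) : ℝ) * f t j| with hs
  have hs' (ε : Fin n → ℤˣ) :
      ⨆ t, |(1 / (n : ℝ)) * ∑ j, ((ε j : ℤ) : ℝ) * f t j| = (1 / (n : ℝ)) * s ε := by
    rw [hs, Real.mul_iSup_of_nonneg (by positivity)]
    congr 1
    funext t
    rw [abs_mul, abs_of_nonneg (by positivity : (0 : ℝ) ≤ 1 / n)]
  simp only [hs']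
  rw [← Finset.mul_sum]
  have key : (1 / (2 : ℝ) ^ n) * ∑ ε, s ε ≤ √(2 * (3 / 2 * ((k : ℝ) + 1)) * (n * q ^ 2)) := by
    refine le_sqrt_of_forall_mul_le (by positivity) (by positivity) fun c hc => ?_
    have h1 : ∑ ε, Real.exp (c * s ε) ≤ 2 ^ (k + 2) * 2 ^ n * Real.exp (n * (c * q) ^ 2 / 2) := by
      rw [← ENNReal.ofReal_le_ofReal_iff (by positivity),
        ENNReal.ofReal_sum_of_nonneg fun _ _ => (Real.exp_pos _).le]
      exact (Finset.sum_le_sum fun ε _ => exp_iSup_le_iSup_exp _ hc).trans (h c hc.le)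
    -- Jensen's inequality: exp of the average over signs is at most the average of exp.
    have h2 := convexOn_exp.map_sum_le (t := Finset.univ) (w := fun _ => 1 / (2 : ℝ) ^ n)
      (p := fun ε => c * s ε) (fun _ _ => by positivity)
      (by rw [Finset.sum_const, Finset.card_univ, nsmul_eq_mul, hcard]; field_simp) (by simp)
    simp only [smul_eq_mul, ← Finset.mul_sum] at h2
    have h3 : Real.exp (1 / 2 ^ n * (c * ∑ ε, s ε))
        ≤ Real.exp ((k + 2) * Real.log 2 + n * (c * q) ^ 2 / 2) := by
      refine h2.trans ((mul_le_mul_of_nonneg_left h1 (by positivity)).trans (le_of_eq ?_))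
      rw [Real.exp_add, mul_comm ((k : ℝ) + 2), Real.exp_mul, Real.exp_log two_pos]
      norm_cast
      push_cast
      field_simp
    have h4 := Real.exp_le_exp.1 h3
    -- Holds at k = 0 because 2 log 2 < 3/2, and log 2 < 3/2 covers the increments. This rounding is
    -- the source of the constant 3.
    have h5 : (k + 2) * Real.log 2 ≤ 3 / 2 * ((k : ℝ) + 1) := by
      have := Real.log_two_lt_d9
      have hk : (0 : ℝ) ≤ k := Nat.cast_nonneg k
      nlinarith
    calc c * (1 / 2 ^ n * ∑ ε, s ε) = 1 / 2 ^ n * (c * ∑ ε, s ε) := by ring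
      _ ≤ _ := h4
      _ ≤ 3 / 2 * ((k : ℝ) + 1) + n * (c * q) ^ 2 / 2 := by gcongr
      _ = _ := by ring
  have h6 : √(2 * (3 / 2 * ((k : ℝ) + 1)) * (n * q ^ 2)) = √(3 * ((k : ℝ) + 1)) * (√n * q) := by
    rw [Real.sqrt_mul (by positivity), Real.sqrt_mul hn'.le, Real.sqrt_sq hq]
    congr 2
    ring
  rw [h6] at key
  calc 1 / 2 ^ n * (1 / n * ∑ ε, s ε) = 1 / n * (1 / 2 ^ n * ∑ ε, s ε) := by ring
    _ ≤ 1 / n * (√(3 * ((k : ℝ) + 1)) * (√n * q)) := by gcongr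
    _ = q * √(3 * ((k : ℝ) + 1)) / √n := by
      have h7 : (n : ℝ) = √n * √n := (Real.mul_self_sqrt hn'.le).symm
      have h8 : √(n : ℝ) ≠ 0 := (Real.sqrt_pos.2 hn').ne'
      rw [h7, Real.sqrt_mul_self (Real.sqrt_nonneg _)]
      field_simp

lemma signExpSum_const_le {T : Type*} {E : Type*} [NormedAddCommGroup E] [InnerProductSpace ℝ E]
    {n : ℕ} (x : Fin n → E) {B : ℝ} (hx : ∀ i, ‖x i‖ ≤ B) {c : ℝ} (hc : 0 ≤ c) :
    signExpSum (fun (_ : T) (ε : Fin n → ℤˣ) => c * ‖∑ j, ((ε j : ℤ) : ℝ) • x j‖)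
      ≤ ENNReal.ofReal (2 * 2 ^ n * Real.exp (n * (c * B) ^ 2 / 2)) := by
  have h := sum_signs_exp_norm_le (fun i => c • x i) (c * B) fun i => by
    rw [norm_smul, Real.norm_of_nonneg hc]
    exact mul_le_mul_of_nonneg_left (hx i) hc
  refine le_trans ?_ (ENNReal.ofReal_le_ofReal h)
  rw [ENNReal.ofReal_sum_of_nonneg fun _ _ => (Real.exp_pos _).le]
  refine Finset.sum_le_sum fun ε _ => iSup_le fun _ => le_of_eq ?_
  simp only [smul_comm _ c, ← Finset.smul_sum, norm_smul, Real.norm_of_nonneg hc]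

/-! ### Rademacher averages of discriminators and of composed networks -/

namespace Arch

variable {A : Arch}

/-- The argument of the final sigmoid of the discriminator. -/
noncomputable def preact (ω : A.DParam) (x : A.Data) : ℝ :=
  inner ℝ ω.w (hidden A.dimD A.r ω.W x A.K le_rfl)

variable (A) in
/-- The Lipschitz constant `M_k ∏ (M_i R_i)` of the networks `preact ω`. -/
noncomputable def discConst : ℝ := A.Mout * ∏ i, (A.M i * A.R i : ℝ)

variable (A) in
/-- The Lipschitz constant `N_l ∏ (N_j S_j)` of the generators. -/
noncomputable def genConst : ℝ := A.Nout * ∏ j, (A.N j * A.S j : ℝ)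

lemma discConst_nonneg : 0 ≤ A.discConst := by unfold discConst; positivity

lemma genConst_nonneg : 0 ≤ A.genConst := by unfold genConst; positivity

lemma abs_preact_le {ω : A.DParam} (hω : ω ∈ A.discSet) {x : A.Data} {B : ℝ} (hx : ‖x‖ ≤ B) :
    |preact ω x| ≤ A.discConst * B := by
  have h1 := norm_hidden_le A.r_lipschitz A.r_posHom ω.W hω.1 x A.K le_rfl
  rw [layerProd_self] at h1
  calc |preact ω x| ≤ ‖ω.w‖ * ‖hidden A.dimD A.r ω.W x A.K le_rfl‖ := abs_real_inner_le_norm _ _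
    _ ≤ A.Mout * ((∏ i, (A.M i * A.R i : ℝ)) * B) := by
        gcongr
        · exact hω.2
        · exact h1.trans (by gcongr)
    _ = _ := by rw [discConst]; ring

lemma norm_gen_le {θ : A.GParam} (hθ : θ ∈ A.genSet) {z : A.Latent} {B : ℝ} (hz : ‖z‖ ≤ B) :
    ‖gen θ z‖ ≤ A.genConst * B := by
  have h1 := norm_hidden_le A.s_lipschitz A.s_posHom θ.V hθ.1 z A.L le_rfl
  rw [layerProd_self] at h1
  calc ‖gen θ z‖ ≤ frobNorm θ.Vout * ‖hidden A.dimG A.s θ.V z A.L le_rfl‖ := norm_linLayer_le _ _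
    _ ≤ A.Nout * ((∏ i, (A.N i * A.S i : ℝ)) * B) := by
        gcongr
        · exact hθ.2
        · exact h1.trans (by gcongr)
    _ = _ := by rw [genConst]; ring

/-- Exponential moments of the Rademacher process of discriminators with a Lipschitz output. -/
lemma signExpSum_disc_le {T : Type*} {n : ℕ} {F : ℝ → ℝ} {Λ : ℝ≥0} {Q : ℝ} (hQ : 0 ≤ Q)
    (hF : LipschitzOnWith Λ F (Set.Icc (-Q) Q)) (hF0 : F 0 = 0)
    (ω : T → A.DParam) (hω : ∀ t, ω t ∈ A.discSet) (x : T → Fin n → A.Data)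
    (hx : ∀ t j, |preact (ω t) (x t j)| ≤ Q) {c : ℝ} (hc : 0 ≤ c) :
    signExpSum (fun t (ε : Fin n → ℤˣ) => c * |∑ j, ((ε j : ℤ) : ℝ) * F (preact (ω t) (x t j))|)
      ≤ 2 ^ (A.K + 1) * signExpSum (fun t (ε : Fin n → ℤˣ) =>
        c * Λ * A.discConst * ‖∑ j, ((ε j : ℤ) : ℝ) • x t j‖) := by
  have hcΛ : 0 ≤ c * (Λ : ℝ) := by positivity
  have h1 := signExpSum_abs_le (fun t (ε : Fin n → ℤˣ) =>
    ∑ j, ((ε j : ℤ) : ℝ) * (c * F (preact (ω t) (x t j)))) (by simp)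
  have h2 := signExpSum_contraction (n := n) (fun _ : T => 0)
    (fun t j => c * F (preact (ω t) (x t j))) (fun t j => c * Λ * preact (ω t) (x t j))
    (fun t s j => by
      rw [← mul_sub, ← mul_sub, abs_mul, abs_of_nonneg hc, abs_mul, abs_of_nonneg hcΛ, mul_assoc]
      exact mul_le_mul_of_nonneg_left
        (hF.dist_le_mul _ (abs_le.1 (hx t j)) _ (abs_le.1 (hx s j))) hc)
    (fun t j => by
      rw [abs_mul, abs_of_nonneg hc, abs_mul, abs_of_nonneg hcΛ, mul_assoc]
      -- F 0 = 0 turns the Lipschitz bound into the pointwise domination that contraction also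
      -- requires.
      have := hF.dist_le_mul _ (abs_le.1 (hx t j)) 0 (by simpa using hQ)
      rw [hF0, dist_zero_right, dist_zero_right] at this
      exact mul_le_mul_of_nonneg_left this hc)
  simp only [zero_add] at h2
  have h3 : signExpSum (fun t (ε : Fin n → ℤˣ) =>
        ∑ j, ((ε j : ℤ) : ℝ) * (c * Λ * preact (ω t) (x t j)))
      ≤ signExpSum (fun t (ε : Fin n → ℤˣ) => c * Λ * A.Mout *
        ‖∑ j, ((ε j : ℤ) : ℝ) • hidden A.dimD A.r (ω t).W (x t j) A.K le_rfl‖) := by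
    refine signExpSum_mono fun t ε => ?_
    have : ∑ j, ((ε j : ℤ) : ℝ) * (c * Λ * preact (ω t) (x t j)) = c * Λ * inner ℝ (ω t).w
        (∑ j, ((ε j : ℤ) : ℝ) • hidden A.dimD A.r (ω t).W (x t j) A.K le_rfl) := by
      rw [inner_sum, Finset.mul_sum]
      exact Finset.sum_congr rfl fun i _ => by rw [real_inner_smul_right, preact]; ring
    rw [this, mul_assoc (c * (Λ : ℝ))]
    refine mul_le_mul_of_nonneg_left ((real_inner_le_norm _ _).trans ?_) hcΛ
    exact mul_le_mul_of_nonneg_right (hω t).2 (norm_nonneg _)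
  have h4 := signExpSum_hidden_le A.r_lipschitz A.r_posHom (fun t => (ω t).W)
    (fun t => (hω t).1) x A.K le_rfl (c := c * Λ * A.Mout) (by positivity)
  rw [layerProd_self] at h4
  have h5 : (fun t (ε : Fin n → ℤˣ) => c * |∑ j, ((ε j : ℤ) : ℝ) * F (preact (ω t) (x t j))|)
      = fun t (ε : Fin n → ℤˣ) => |∑ j, ((ε j : ℤ) : ℝ) * (c * F (preact (ω t) (x t j)))| := by
    funext t ε
    rw [← abs_of_nonneg hc, ← abs_mul, Finset.mul_sum, abs_of_nonneg hc]
    exact congrArg _ (Finset.sum_congr rfl fun j _ => by ring)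
  rw [h5, pow_succ', mul_assoc]
  refine h1.trans (mul_le_mul_right ((h2.trans h3).trans (h4.trans (le_of_eq ?_))) 2)
  simp only [discConst, mul_assoc]

/-- The doublings number K + 2: one for the output, one for each hidden layer, and one from exp ≤ 2
cosh on the inputs. -/
lemma signAverage_disc_le {n : ℕ} (hn : 0 < n) {F : ℝ → ℝ} {Λ : ℝ≥0} {B : ℝ} (hB : 0 ≤ B)
    (hF : LipschitzOnWith Λ F (Set.Icc (-A.Qx B) (A.Qx B))) (hF0 : F 0 = 0)
    [Nonempty A.discSet] (x : Fin n → A.Data) (hx : ∀ j, ‖x j‖ ≤ B) :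
    (1 / (2 : ℝ) ^ n) * ∑ ε : Fin n → ℤˣ, ⨆ ω : A.discSet,
        |(1 / (n : ℝ)) * ∑ j, ((ε j : ℤ) : ℝ) * F (preact ω.1 (x j))|
      ≤ Λ * A.Qx B * √(3 * ((A.K : ℝ) + 1)) / √n := by
  have hQ : 0 ≤ A.Qx B := mul_nonneg discConst_nonneg hB
  refine signAverage_le hn A.K (by positivity) _ fun c hc => ?_
  refine (signExpSum_disc_le hQ hF hF0 (fun ω : A.discSet => ω.1) (fun ω => ω.2) (fun _ => x)
    (fun ω j => abs_preact_le ω.2 (hx j)) hc).trans ?_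
  have hd := A.discConst_nonneg
  refine (mul_le_mul_right (signExpSum_const_le x hx (by positivity)) _).trans (le_of_eq ?_)
  rw [show (2 : ℝ≥0∞) ^ (A.K + 1) = ENNReal.ofReal (2 ^ (A.K + 1)) by
      rw [ENNReal.ofReal_pow two_pos.le, ENNReal.ofReal_ofNat],
    ← ENNReal.ofReal_mul (by positivity), Qx, ← discConst]
  congr 1
  rw [show c * (Λ * (A.discConst * B)) = c * Λ * A.discConst * B by ring]
  ring

/-- The generator's output layer is linear, so it commutes with the sign sum and costs only its
norm, without a doubling. Only its L hidden layers add to the count, whence k + l - 1 and not k + l.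
-/
lemma signAverage_discGen_le {n : ℕ} (hn : 0 < n) {F : ℝ → ℝ} {Λ : ℝ≥0} {B : ℝ} (hB : 0 ≤ B)
    (hF : LipschitzOnWith Λ F (Set.Icc (-A.Qz B) (A.Qz B))) (hF0 : F 0 = 0)
    [Nonempty (A.discSet × A.genSet)] (z : Fin n → A.Latent) (hz : ∀ j, ‖z j‖ ≤ B) :
    (1 / (2 : ℝ) ^ n) * ∑ ε : Fin n → ℤˣ, ⨆ q : A.discSet × A.genSet,
        |(1 / (n : ℝ)) * ∑ j, ((ε j : ℤ) : ℝ) * F (preact q.1.1 (gen q.2.1 (z j)))|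
      ≤ Λ * A.Qz B * √(3 * ((A.K : ℝ) + 1 + (A.L + 1) - 1)) / √n := by
  have hd := A.discConst_nonneg
  have hg := A.genConst_nonneg
  have hQeq : A.Qz B = A.discConst * (A.genConst * B) := by
    rw [Qz, discConst, genConst, mul_assoc]
  have hQ : 0 ≤ A.Qz B := by rw [hQeq]; positivity
  rw [show (A.K : ℝ) + 1 + (A.L + 1) - 1 = ((A.K + A.L : ℕ) : ℝ) + 1 by push_cast; ring]
  refine signAverage_le hn (A.K + A.L) (by positivity) _ fun c hc => ?_
  refine (signExpSum_disc_le hQ hF hF0 (fun q : A.discSet × A.genSet => q.1.1) (fun q => q.1.2)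
    (fun q j => gen q.2.1 (z j))
    (fun q j => hQeq ▸ abs_preact_le q.1.2 (norm_gen_le q.2.2 (hz j))) hc).trans ?_
  have h1 : signExpSum (fun (q : A.discSet × A.genSet) (ε : Fin n → ℤˣ) =>
        c * Λ * A.discConst * ‖∑ j, ((ε j : ℤ) : ℝ) • gen q.2.1 (z j)‖)
      ≤ signExpSum (fun (q : A.discSet × A.genSet) (ε : Fin n → ℤˣ) =>
        c * Λ * A.discConst * A.Nout *
          ‖∑ j, ((ε j : ℤ) : ℝ) • hidden A.dimG A.s q.2.1.V (z j) A.L le_rfl‖) := by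
    refine signExpSum_mono fun q ε => ?_
    simp only [gen]
    rw [← linLayer_sum_smul, mul_assoc _ (A.Nout : ℝ)]
    gcongr
    exact (norm_linLayer_le _ _).trans (mul_le_mul_of_nonneg_right q.2.2.2 (norm_nonneg _))
  have h2 := signExpSum_hidden_le A.s_lipschitz A.s_posHom
    (fun q : A.discSet × A.genSet => q.2.1.V) (fun q => q.2.2.1) (fun _ => z) A.L le_rfl
    (c := c * Λ * A.discConst * A.Nout) (by positivity)
  have h3 := signExpSum_const_le (T := A.discSet × A.genSet) z hz
    (c := c * Λ * A.discConst * A.Nout * layerProd A.N A.S A.L)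
    (mul_nonneg (by positivity) (layerProd_nonneg _ _ _))
  refine (mul_le_mul_right (h1.trans (h2.trans (mul_le_mul_right h3 _))) _).trans (le_of_eq ?_)
  rw [← mul_assoc, ← pow_add, show (2 : ℝ≥0∞) ^ (A.K + 1 + A.L)
      = ENNReal.ofReal (2 ^ (A.K + 1 + A.L)) by
      rw [ENNReal.ofReal_pow two_pos.le, ENNReal.ofReal_ofNat],
    ← ENNReal.ofReal_mul (by positivity), hQeq, layerProd_self, genConst]
  congr 1
  rw [show c * Λ * A.discConst * A.Nout * (∏ j, (A.N j * A.S j : ℝ)) * B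
    = c * (Λ * (A.discConst * (A.Nout * (∏ j, (A.N j * A.S j : ℝ)) * B))) by ring]
  ring

end Arch

/-! ### McDiarmid's inequality -/

lemma integrable_of_measurable_of_abs_le {Ω : Type*} [MeasurableSpace Ω] {μ : Measure Ω}
    [IsFiniteMeasure μ] {f : Ω → ℝ} (hf : Measurable f) {C : ℝ} (hC : ∀ x, |f x| ≤ C) :
    Integrable f μ :=
  Integrable.of_bound hf.aestronglyMeasurable C (ae_of_all _ hC)

lemma abs_integral_le_of_abs_le {Ω : Type*} [MeasurableSpace Ω] {μ : Measure Ω}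
    [IsProbabilityMeasure μ] {f : Ω → ℝ} {C : ℝ} (hC : ∀ᵐ x ∂μ, |f x| ≤ C) :
    |∫ x, f x ∂μ| ≤ C := by
  simpa using norm_integral_le_of_norm_le_const (μ := μ) (f := f) hC

/-- **McDiarmid's inequality**, as a sub-Gaussian bound. -/
lemma hasSubgaussianMGF_of_bounded_differences {E : Type*} [MeasurableSpace E] (P : Measure E)
    [IsProbabilityMeasure P] {n : ℕ} {f : (Fin n → E) → ℝ} (hf : Measurable f) {C : ℝ}
    (hC : ∀ y, |f y| ≤ C) {c : ℝ≥0} (hc : ∀ y i e, |f (Function.update y i e) - f y| ≤ c) :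
    HasSubgaussianMGF (fun y => f y - ∫ y, f y ∂(Measure.pi fun _ : Fin n => P))
      (n * (c / 2) ^ 2) (Measure.pi fun _ : Fin n => P) := by
  induction n with
  | zero =>
    have h : (fun y => f y - ∫ y, f y ∂(Measure.pi fun _ : Fin 0 => P)) = fun _ => 0 := by
      funext y
      have : ∀ y', f y' = f y := fun y' => by rw [Subsingleton.elim y' y]
      simp [this]
    rw [h]
    simp
  | succ n ih =>
    set π := Measure.pi fun _ : Fin n => P with hπ
    have hfun : (fun q : E × (Fin n → E) => (Fin.cons q.1 q.2 : Fin (n + 1) → E))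
        = (MeasurableEquiv.piFinSuccAbove (fun _ : Fin (n + 1) => E) 0).symm := by
      funext q
      exact (Fin.insertNth_zero' q.1 q.2).symm
    have hcons : Measurable fun q : E × (Fin n → E) => (Fin.cons q.1 q.2 : Fin (n + 1) → E) :=
      hfun ▸ (MeasurableEquiv.piFinSuccAbove (fun _ : Fin (n + 1) => E) 0).symm.measurable
    have hmp : MeasurePreserving (fun q : E × (Fin n → E) => (Fin.cons q.1 q.2 : Fin (n + 1) → E))
        (P.prod π) (Measure.pi fun _ : Fin (n + 1) => P) :=
      hfun ▸ (measurePreserving_piFinSuccAbove (fun _ : Fin (n + 1) => P) 0).symm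
    have hcomp (h : (Fin (n + 1) → E) → ℝ) (hm : Measurable h) :
        ∫ y, h y ∂(Measure.pi fun _ : Fin (n + 1) => P)
          = ∫ q, h (Fin.cons q.1 q.2) ∂(P.prod π) := by
      rw [← hmp.map_eq, integral_map hmp.measurable.aemeasurable hm.aestronglyMeasurable]
    have hF : Measurable fun q : E × (Fin n → E) => f (Fin.cons q.1 q.2) := hf.comp hcons
    have hFx (x : E) : Measurable fun y : Fin n → E => f (Fin.cons x y) :=
      hF.comp measurable_prodMk_left
    -- g is the conditional expectation given the first coordinate. For fixed x, the induction
    -- hypothesis handles f - g and Hoeffding's lemma handles g - E g; the two parameters add.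
    set g : E → ℝ := fun x => ∫ y, f (Fin.cons x y) ∂π with hg
    have hgm : Measurable g := hF.stronglyMeasurable.integral_prod_right.measurable
    have hgC (x : E) : |g x| ≤ C := abs_integral_le_of_abs_le (ae_of_all _ fun y => hC _)
    have hgc (x x' : E) : g x - g x' ≤ c := by
      rw [hg]
      beta_reduce
      rw [← integral_sub (integrable_of_measurable_of_abs_le (hFx x) fun y => hC _)
        (integrable_of_measurable_of_abs_le (hFx x') fun y => hC _)]
      refine (le_abs_self _).trans (abs_integral_le_of_abs_le (ae_of_all _ fun y => ?_))
      have := hc (Fin.cons x' y) 0 x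
      rwa [Fin.update_cons_zero] at this
    have : Nonempty E := P.nonempty_of_neZero
    have hbdd : BddBelow (Set.range g) := ⟨-C, by
      rintro _ ⟨x, rfl⟩
      exact (abs_le.1 (hgC x)).1⟩
    have hgsub : HasSubgaussianMGF (fun x => g x - ∫ x, g x ∂P) ((c / 2) ^ 2) P := by
      -- Any two values of g differ by at most c, so the range fits in an interval of length c
      -- starting at its infimum.
      have := hasSubgaussianMGF_of_mem_Icc (μ := P) (a := ⨅ x, g x) (b := (⨅ x, g x) + c)
        hgm.aemeasurable (ae_of_all _ fun x => ⟨ciInf_le hbdd x, by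
          have : g x - c ≤ ⨅ x, g x := le_ciInf fun x' => by linarith [hgc x x']
          linarith⟩)
      rwa [add_sub_cancel_left, NNReal.nnnorm_eq] at this
    have hint : ∫ y, f y ∂(Measure.pi fun _ : Fin (n + 1) => P) = ∫ x, g x ∂P := by
      rw [hcomp f hf, integral_prod _ (integrable_of_measurable_of_abs_le hF fun _ => hC _)]
    have hsub (x : E) := ih (hFx x) (fun y => hC _) fun y i e => by
      have := hc (Fin.cons x y) i.succ e
      rwa [← Fin.cons_update] at this
    have hexp (t a b : ℝ) (ha : |a| ≤ C) (hb : |b| ≤ C) :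
        |Real.exp (t * (a - b))| ≤ Real.exp (|t| * (2 * C)) := by
      rw [Real.abs_exp]
      refine Real.exp_le_exp.2 ((le_abs_self _).trans ?_)
      rw [abs_mul]
      exact mul_le_mul_of_nonneg_left ((abs_sub a b).trans (by linarith)) (abs_nonneg t)
    have hIC : |∫ x, g x ∂P| ≤ C := abs_integral_le_of_abs_le (ae_of_all _ hgC)
    rw [hint]
    refine ⟨fun t => integrable_of_measurable_of_abs_le (by fun_prop)
      fun y => hexp t _ _ (hC y) hIC, fun t => ?_⟩
    have hmeas : Measurable fun y => Real.exp (t * (f y - ∫ x, g x ∂P)) := by fun_prop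
    have hin (x : E) : ∫ y, Real.exp (t * (f (Fin.cons x y) - ∫ x, g x ∂P)) ∂π
        ≤ Real.exp (t * (g x - ∫ x, g x ∂P)) * Real.exp (n * (c / 2) ^ 2 * t ^ 2 / 2) := by
      have h1 := (hsub x).mgf_le t
      rw [mgf] at h1
      calc _ = ∫ y, Real.exp (t * (g x - ∫ x, g x ∂P))
              * Real.exp (t * (f (Fin.cons x y) - g x)) ∂π := by
            refine integral_congr_ae (ae_of_all _ fun y => ?_)
            beta_reduce
            rw [← Real.exp_add]
            ring_nf
        _ ≤ _ := by
            rw [integral_const_mul]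
            refine mul_le_mul_of_nonneg_left ?_ (Real.exp_pos _).le
            exact_mod_cast h1
    rw [mgf, hcomp _ hmeas, integral_prod _ (integrable_of_measurable_of_abs_le
      (by exact hmeas.comp hcons) fun q => hexp t _ _ (hC _) hIC)]
    have h2 := hgsub.mgf_le t
    rw [mgf] at h2
    calc _ ≤ ∫ x, Real.exp (t * (g x - ∫ x, g x ∂P))
              * Real.exp (n * (c / 2) ^ 2 * t ^ 2 / 2) ∂P := by
          refine integral_mono_of_nonneg
            (ae_of_all _ fun x => integral_nonneg fun y => (Real.exp_pos _).le)
            ((hgsub.integrable_exp_mul t).mul_const _) (ae_of_all _ hin)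
      _ ≤ Real.exp ((c / 2) ^ 2 * t ^ 2 / 2) * Real.exp (n * (c / 2) ^ 2 * t ^ 2 / 2) := by
          rw [integral_mul_const]
          refine mul_le_mul_of_nonneg_right ?_ (Real.exp_pos _).le
          exact_mod_cast h2
      _ = _ := by
          rw [← Real.exp_add]
          push_cast
          ring_nf

/-- Chernoff's bound exp(-2u²/(nc²)) equals δ at u = c √(n log(1/δ)/2). The degenerate parameter 0
is separate, as the exponent would divide by 0; there f equals its mean almost surely. -/
lemma measure_integral_add_lt_le {E : Type*} [MeasurableSpace E] (P : Measure E)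
    [IsProbabilityMeasure P] {n : ℕ} {f : (Fin n → E) → ℝ} (hf : Measurable f) {C : ℝ}
    (hC : ∀ y, |f y| ≤ C) {c : ℝ≥0} (hc : ∀ y i e, |f (Function.update y i e) - f y| ≤ c)
    {δ : ℝ} (hδ : 0 < δ) (hδ1 : δ < 1) :
    (Measure.pi fun _ : Fin n => P) {y | (∫ y, f y ∂(Measure.pi fun _ : Fin n => P))
        + c * √(n * Real.log (1 / δ) / 2) < f y} ≤ ENNReal.ofReal δ := by
  set π := Measure.pi fun _ : Fin n => P
  have hsub := hasSubgaussianMGF_of_bounded_differences P hf hC hc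
  have hlog : 0 < Real.log (1 / δ) := Real.log_pos (by rwa [lt_div_iff₀ hδ, one_mul])
  rcases eq_or_ne ((n : ℝ≥0) * (c / 2) ^ 2) 0 with h0 | h0
  · rw [h0] at hsub
    have h1 := HasSubgaussianMGF.ae_eq_zero_of_hasSubgaussianMGF_zero hsub
    refine le_trans (le_of_eq ?_) zero_le
    refine measure_mono_null (t := {y | ¬ (f y - ∫ y, f y ∂π = 0)}) (fun y hy => ?_) h1
    have : 0 ≤ (c : ℝ) * √(n * Real.log (1 / δ) / 2) := by positivity
    have hy' : (∫ y, f y ∂π) + c * √(n * Real.log (1 / δ) / 2) < f y := hy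
    exact (by linarith : (0 : ℝ) < f y - ∫ y, f y ∂π).ne'
  · have hn : (0 : ℝ) < n := by
      rcases Nat.eq_zero_or_pos n with h | h
      · simp [h] at h0
      · exact_mod_cast h
    have hc0 : (0 : ℝ) < c := by
      rcases eq_or_ne c 0 with h | h
      · simp [h] at h0
      · exact_mod_cast pos_iff_ne_zero.2 h
    have h1 := hsub.measure_ge_le (ε := c * √(n * Real.log (1 / δ) / 2)) (by positivity)
    have h2 : Real.exp (-(c * √(n * Real.log (1 / δ) / 2)) ^ 2
        / (2 * ((n : ℝ≥0) * (c / 2) ^ 2 : ℝ≥0))) = δ := by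
      rw [mul_pow, Real.sq_sqrt (by positivity)]
      push_cast
      rw [show -((c : ℝ) ^ 2 * (n * Real.log (1 / δ) / 2)) / (2 * (n * ((c : ℝ) / 2) ^ 2))
        = Real.log δ by rw [one_div, Real.log_inv]; field_simp, Real.exp_log hδ]
    rw [h2] at h1
    refine (measure_mono fun y hy => ?_).trans
      ((ENNReal.le_ofReal_iff_toReal_le (measure_ne_top _ _) hδ.le).2 h1)
    have hy' : (∫ y, f y ∂π) + c * √(n * Real.log (1 / δ) / 2) < f y := hy
    change _ ≤ f y - ∫ y, f y ∂π
    linarith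

/-! ### Uniform deviations: measurability, concentration and symmetrization -/

set_option linter.unusedSectionVars false

/-- Continuity in the parameter reduces the uncountable supremum to a countable dense set. -/
lemma measurable_iSup_of_continuous {ι Ω : Type*} [TopologicalSpace ι] [SecondCountableTopology ι]
    [MeasurableSpace Ω] {F : ι → Ω → ℝ} (hm : ∀ i, Measurable (F i))
    (hc : ∀ x, Continuous fun i => F i x) : Measurable fun x => ⨆ i, F i x := by
  obtain ⟨s, hs, hd⟩ := TopologicalSpace.exists_countable_dense ι
  have := hs.to_subtype
  have h : (fun x => ⨆ i, F i x) = fun x => ⨆ i : s, F i x :=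
    funext fun x => (hd.ciSup' (hc x)).symm
  rw [h]
  exact Measurable.iSup fun i => hm i

/-- A family of measurable functions, continuous in the parameter, which is bounded by `C` and has
oscillation at most `c` on `s`. -/
structure IsBoundedFamily {ι E : Type*} [TopologicalSpace ι] [MeasurableSpace E]
    (g : ι → E → ℝ) (s : Set E) (C : ℝ) (c : ℝ≥0) : Prop where
  measurable : ∀ i, Measurable (g i)
  continuous : ∀ e, Continuous fun i => g i e
  bound : ∀ i, ∀ e ∈ s, |g i e| ≤ C
  oscillation : ∀ i, ∀ e ∈ s, ∀ e' ∈ s, |g i e - g i e'| ≤ c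

lemma abs_mean_le {n : ℕ} {a : Fin n → ℝ} {C : ℝ} (hC0 : 0 ≤ C) (h : ∀ j, |a j| ≤ C) :
    |(1 / (n : ℝ)) * ∑ j, a j| ≤ C := by
  rcases Nat.eq_zero_or_pos n with rfl | hn
  · simpa using hC0
  have hn' : (0 : ℝ) < n := Nat.cast_pos.2 hn
  rw [abs_mul, abs_of_nonneg (by positivity)]
  calc 1 / (n : ℝ) * |∑ j, a j| ≤ 1 / n * ∑ _j : Fin n, C := by
        gcongr
        exact (Finset.abs_sum_le_sum_abs _ _).trans (Finset.sum_le_sum fun j _ => h j)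
    _ = C := by simp [hn'.ne']

lemma abs_iSup_abs_le {ι : Type*} {a : ι → ℝ} {C : ℝ} (hC0 : 0 ≤ C) (h : ∀ i, |a i| ≤ C) :
    |(⨆ i, |a i|)| ≤ C := by
  rw [abs_of_nonneg (Real.iSup_nonneg fun i => abs_nonneg _)]
  exact Real.iSup_le h hC0

lemma iSup_abs_sub_le {ι : Type*} [Nonempty ι] {a b : ι → ℝ} {C c : ℝ}
    (hb : ∀ i, |b i| ≤ C) (h : ∀ i, |a i - b i| ≤ c) : (⨆ i, |a i|) ≤ (⨆ i, |b i|) + c := by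
  refine ciSup_le fun i => ?_
  have h1 : |b i| ≤ ⨆ i, |b i| := le_ciSup (f := fun i => |b i|)
    ⟨C, by rintro _ ⟨i, rfl⟩; exact hb i⟩ i
  have h2 := abs_sub_abs_le_abs_sub (a i) (b i)
  linarith [h i]

lemma coe_sign_abs (e : ℤˣ) : |((e : ℤ) : ℝ)| = 1 := by
  rcases Int.units_eq_one_or e with h | h <;> simp [h]

namespace IsBoundedFamily

variable {ι E : Type*} [TopologicalSpace ι] [SecondCountableTopology ι] [Nonempty ι]
  [MeasurableSpace E] {P : Measure E} [IsProbabilityMeasure P] {g : ι → E → ℝ} {C : ℝ} {c : ℝ≥0}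
  {n : ℕ}

lemma bound_nonneg [Nonempty E] (h : IsBoundedFamily g Set.univ C c) : 0 ≤ C :=
  (abs_nonneg _).trans (h.bound (Classical.arbitrary ι) (Classical.arbitrary E) trivial)

lemma continuous_integral (h : IsBoundedFamily g Set.univ C c) :
    Continuous fun i => ∫ e, g i e ∂P :=
  continuous_of_dominated (fun i => (h.measurable i).aestronglyMeasurable)
    (fun i => ae_of_all _ fun e => h.bound i e trivial) (integrable_const C)
    (ae_of_all _ h.continuous)

lemma measurable_uniformDev (h : IsBoundedFamily g Set.univ C c) :
    Measurable fun y : Fin n → E => uniformDev P g y := by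
  refine measurable_iSup_of_continuous (fun i => ?_) fun y => ?_
  · have := h.measurable i
    fun_prop
  · have := h.continuous
    have := h.continuous_integral (P := P)
    fun_prop

lemma abs_dev_le [Nonempty E] (h : IsBoundedFamily g Set.univ C c) (i : ι) (y : Fin n → E) :
    |(∫ e, g i e ∂P) - (1 / (n : ℝ)) * ∑ j, g i (y j)| ≤ 2 * C := by
  refine (abs_sub _ _).trans ?_
  rw [two_mul]
  exact add_le_add (abs_integral_le_of_abs_le (ae_of_all _ fun e => h.bound i e trivial))
    (abs_mean_le h.bound_nonneg fun j => h.bound i _ trivial)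

lemma abs_uniformDev_le [Nonempty E] (h : IsBoundedFamily g Set.univ C c) (y : Fin n → E) :
    |uniformDev P g y| ≤ 2 * C :=
  abs_iSup_abs_le (mul_nonneg two_pos.le h.bound_nonneg) fun i => h.abs_dev_le i y

/-- Replacing one sample point changes one summand of each mean, and a supremum of absolute values
moves no more than its terms. This is the bounded difference for McDiarmid's inequality. -/
lemma abs_uniformDev_update_sub_le [Nonempty E] (h : IsBoundedFamily g Set.univ C c)
    (y : Fin n → E) (k : Fin n) (e : E) :
    |uniformDev P g (Function.update y k e) - uniformDev P g y| ≤ c / n := by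
  have key (y : Fin n → E) (e : E) (i : ι) :
      |((∫ e, g i e ∂P) - (1 / (n : ℝ)) * ∑ j, g i (Function.update y k e j))
        - ((∫ e, g i e ∂P) - (1 / (n : ℝ)) * ∑ j, g i (y j))| ≤ c / n := by
    have h1 : ∑ j, g i (y j) - ∑ j, g i (Function.update y k e j) = g i (y k) - g i e := by
      rw [← Finset.sum_sub_distrib, Finset.sum_eq_single k]
      · simp
      · intro j _ hj
        simp [hj]
      · simp
    rw [sub_sub_sub_cancel_left, ← mul_sub, h1, abs_mul, abs_of_nonneg (by positivity),
      one_div, inv_mul_eq_div]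
    exact div_le_div_of_nonneg_right (h.oscillation i _ trivial _ trivial) (Nat.cast_nonneg n)
  rw [abs_le]
  constructor
  · have : uniformDev P g y ≤ uniformDev P g (Function.update y k e) + c / n :=
      iSup_abs_sub_le (fun i => h.abs_dev_le i (Function.update y k e))
        fun i => (abs_sub_comm _ _).trans_le (key y e i)
    linarith
  · have : uniformDev P g (Function.update y k e) ≤ uniformDev P g y + c / n :=
      iSup_abs_sub_le (fun i => h.abs_dev_le i y) (key y e)
    linarith

lemma measure_uniformDev_le_of_univ (h : IsBoundedFamily g Set.univ C c) (hn : 0 < n) {δ : ℝ}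
    (hδ : 0 < δ) (hδ1 : δ < 1) :
    (Measure.pi fun _ : Fin n => P) {y | (∫ y, uniformDev P g y ∂(Measure.pi fun _ : Fin n => P))
        + c * √(Real.log (1 / δ) / (2 * n)) < uniformDev P g y} ≤ ENNReal.ofReal δ := by
  have : Nonempty E := P.nonempty_of_neZero
  have hn' : (0 : ℝ) < n := Nat.cast_pos.2 hn
  have h1 := measure_integral_add_lt_le P h.measurable_uniformDev h.abs_uniformDev_le
    (c := c / n) (fun y k e => by simpa using h.abs_uniformDev_update_sub_le (P := P) y k e) hδ hδ1
  have hlog : 0 < Real.log (1 / δ) := Real.log_pos (by rwa [lt_div_iff₀ hδ, one_mul])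
  have h2 : ((c / n : ℝ≥0) : ℝ) * √(n * Real.log (1 / δ) / 2)
      = c * √(Real.log (1 / δ) / (2 * n)) := by
    rw [show n * Real.log (1 / δ) / 2 = (n : ℝ) ^ 2 * (Real.log (1 / δ) / (2 * n)) by field_simp,
      Real.sqrt_mul (by positivity), Real.sqrt_sq hn'.le]
    push_cast
    field_simp
  rwa [h2] at h1

section Symmetrization

/-- `sup_i |(1/n) ∑ ε_j (g_i(y'_j) - g_i(y_j))|`. -/
noncomputable def ghostDev (g : ι → E → ℝ) (ε : Fin n → ℤˣ) (q : (Fin n → E) × (Fin n → E)) : ℝ :=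
  ⨆ i, |(1 / (n : ℝ)) * ∑ j, ((ε j : ℤ) : ℝ) * (g i (q.2 j) - g i (q.1 j))|

/-- `sup_i |(1/n) ∑ ε_j g_i(y_j)|`. -/
noncomputable def signDev (g : ι → E → ℝ) (ε : Fin n → ℤˣ) (y : Fin n → E) : ℝ :=
  ⨆ i, |(1 / (n : ℝ)) * ∑ j, ((ε j : ℤ) : ℝ) * g i (y j)|

lemma abs_signMean_le [Nonempty E] (h : IsBoundedFamily g Set.univ C c) (ε : Fin n → ℤˣ)
    (i : ι) (y : Fin n → E) :
    |(1 / (n : ℝ)) * ∑ j, ((ε j : ℤ) : ℝ) * g i (y j)| ≤ C :=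
  abs_mean_le h.bound_nonneg fun j => by
    rw [abs_mul, coe_sign_abs, one_mul]
    exact h.bound i _ trivial

lemma abs_ghostMean_le [Nonempty E] (h : IsBoundedFamily g Set.univ C c) (ε : Fin n → ℤˣ)
    (i : ι) (q : (Fin n → E) × (Fin n → E)) :
    |(1 / (n : ℝ)) * ∑ j, ((ε j : ℤ) : ℝ) * (g i (q.2 j) - g i (q.1 j))| ≤ 2 * C :=
  abs_mean_le (mul_nonneg two_pos.le h.bound_nonneg) fun j => by
    rw [abs_mul, coe_sign_abs, one_mul, two_mul]
    exact (abs_sub _ _).trans (add_le_add (h.bound i _ trivial) (h.bound i _ trivial))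

lemma measurable_signDev (h : IsBoundedFamily g Set.univ C c) (ε : Fin n → ℤˣ) :
    Measurable (signDev g ε) := by
  refine measurable_iSup_of_continuous (fun i => ?_) fun y => ?_
  · have := h.measurable i
    fun_prop
  · have := h.continuous
    fun_prop

lemma measurable_ghostDev (h : IsBoundedFamily g Set.univ C c) (ε : Fin n → ℤˣ) :
    Measurable (ghostDev g ε) := by
  refine measurable_iSup_of_continuous (fun i => ?_) fun y => ?_
  · have := h.measurable i
    fun_prop
  · have := h.continuous
    fun_prop

lemma integrable_signDev (h : IsBoundedFamily g Set.univ C c) (ε : Fin n → ℤˣ) :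
    Integrable (signDev g ε) (Measure.pi fun _ : Fin n => P) :=
  have : Nonempty E := P.nonempty_of_neZero
  integrable_of_measurable_of_abs_le (h.measurable_signDev ε) (C := C)
    fun y => abs_iSup_abs_le h.bound_nonneg fun i => h.abs_signMean_le ε i y

lemma integrable_ghostDev (h : IsBoundedFamily g Set.univ C c) (ε : Fin n → ℤˣ) :
    Integrable (ghostDev g ε) ((Measure.pi fun _ : Fin n => P).prod (Measure.pi fun _ => P)) :=
  have : Nonempty E := P.nonempty_of_neZero
  integrable_of_measurable_of_abs_le (h.measurable_ghostDev ε) (C := 2 * C)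
    fun q => abs_iSup_abs_le (mul_nonneg two_pos.le h.bound_nonneg) fun i => h.abs_ghostMean_le ε i q

/-- The expectation is rewritten as the mean over an independent ghost sample; the supremum of an
integral is at most the integral of the supremum. -/
lemma uniformDev_le_integral_ghostDev (h : IsBoundedFamily g Set.univ C c) (hn : 0 < n)
    (y : Fin n → E) :
    uniformDev P g y ≤ ∫ y', ghostDev g 1 (y, y') ∂(Measure.pi fun _ : Fin n => P) := by
  have : Nonempty E := P.nonempty_of_neZero
  have hn' : (n : ℝ) ≠ 0 := (Nat.cast_pos.2 hn).ne'
  refine ciSup_le fun i => ?_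
  have hint (j : Fin n) : Integrable (fun y' : Fin n → E => g i (y' j))
      (Measure.pi fun _ : Fin n => P) :=
    integrable_of_measurable_of_abs_le ((h.measurable i).comp (measurable_pi_apply j))
      fun y' => h.bound i _ trivial
  have heval (j : Fin n) :
      ∫ y', g i (y' j) ∂(Measure.pi fun _ : Fin n => P) = ∫ e, g i e ∂P := by
    have hmp := measurePreserving_eval (fun _ : Fin n => P) j
    conv_rhs => rw [← hmp.map_eq]
    rw [integral_map hmp.measurable.aemeasurable (h.measurable i).aestronglyMeasurable]
  have h1 : (∫ e, g i e ∂P) - (1 / (n : ℝ)) * ∑ j, g i (y j)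
      = ∫ y', (1 / (n : ℝ)) * ∑ j, (((1 : Fin n → ℤˣ) j : ℤ) : ℝ) * (g i (y' j) - g i (y j))
        ∂(Measure.pi fun _ : Fin n => P) := by
    simp only [Pi.one_apply, Units.val_one, Int.cast_one, one_mul]
    have hint' (j : Fin n) : Integrable (fun y' : Fin n → E => g i (y' j) - g i (y j))
        (Measure.pi fun _ : Fin n => P) := (hint j).sub (integrable_const _)
    rw [integral_const_mul, integral_finsetSum _ fun j _ => hint' j]
    simp_rw [integral_sub (hint _) (integrable_const _), heval]
    simp only [integral_const, probReal_univ, one_smul, Finset.sum_sub_distrib, Finset.sum_const,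
      Finset.card_univ, Fintype.card_fin, nsmul_eq_mul, mul_sub]
    field_simp
  rw [h1]
  refine (abs_integral_le_integral_abs).trans (integral_mono_of_nonneg
    (ae_of_all _ fun _ => abs_nonneg _) (integrable_of_measurable_of_abs_le (C := 2 * C)
      ((h.measurable_ghostDev 1).comp measurable_prodMk_left) fun q =>
        abs_iSup_abs_le (mul_nonneg two_pos.le h.bound_nonneg) fun i => h.abs_ghostMean_le 1 i (y, q))
    (ae_of_all _ fun y' => ?_))
  exact le_ciSup (f := fun i => |(1 / (n : ℝ)) * ∑ j,
    (((1 : Fin n → ℤˣ) j : ℤ) : ℝ) * (g i (y' j) - g i (y j))|)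
    ⟨2 * C, by rintro _ ⟨i, rfl⟩; exact h.abs_ghostMean_le 1 i (y, y')⟩ i

lemma integral_ghostDev_eq (h : IsBoundedFamily g Set.univ C c) (ε : Fin n → ℤˣ) :
    ∫ q, ghostDev g 1 q ∂((Measure.pi fun _ : Fin n => P).prod (Measure.pi fun _ => P))
      = ∫ q, ghostDev g ε q ∂((Measure.pi fun _ : Fin n => P).prod (Measure.pi fun _ => P)) := by
  have hunzip := measurePreserving_arrowProdEquivProdArrow E E (Fin n) (fun _ => P) fun _ => P
  -- Exchanging the two samples at the indices with ε j = -1 preserves their joint law and flips the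
  -- sign of exactly those differences.
  have hswap : MeasurePreserving
      (fun (q : Fin n → E × E) j => (if ε j = 1 then id else Prod.swap : E × E → E × E) (q j))
      (Measure.pi fun _ => P.prod P) (Measure.pi fun _ => P.prod P) :=
    measurePreserving_pi _ _ fun j => by
      split_ifs
      · exact MeasurePreserving.id _
      · exact Measure.measurePreserving_swap
  rw [← hunzip.map_eq,
    integral_map hunzip.measurable.aemeasurable (h.measurable_ghostDev _).aestronglyMeasurable,
    integral_map hunzip.measurable.aemeasurable (h.measurable_ghostDev _).aestronglyMeasurable]
  conv_lhs => rw [← hswap.map_eq]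
  have hm : Measurable fun q => ghostDev g 1 (MeasurableEquiv.arrowProdEquivProdArrow E E (Fin n) q) :=
    (h.measurable_ghostDev _).comp hunzip.measurable
  rw [integral_map hswap.measurable.aemeasurable hm.aestronglyMeasurable]
  refine integral_congr_ae (ae_of_all _ fun q => ?_)
  simp only [ghostDev, MeasurableEquiv.arrowProdEquivProdArrow, MeasurableEquiv.coe_mk,
    Equiv.arrowProdEquivProdArrow_apply]
  congr 1
  funext i
  congr 2
  refine Finset.sum_congr rfl fun j _ => ?_
  rcases Int.units_eq_one_or (ε j) with hj | hj
  · simp [hj]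
  · simp [hj]

lemma integral_ghostDev_le (h : IsBoundedFamily g Set.univ C c) (ε : Fin n → ℤˣ) :
    ∫ q, ghostDev g ε q ∂((Measure.pi fun _ : Fin n => P).prod (Measure.pi fun _ => P))
      ≤ 2 * ∫ y, signDev g ε y ∂(Measure.pi fun _ : Fin n => P) := by
  have : Nonempty E := P.nonempty_of_neZero
  set π := Measure.pi fun _ : Fin n => P
  have hle (q : (Fin n → E) × (Fin n → E)) :
      ghostDev g ε q ≤ signDev g ε q.2 + signDev g ε q.1 := by
    have hb (y : Fin n → E) (i : ι) :
        |(1 / (n : ℝ)) * ∑ j, ((ε j : ℤ) : ℝ) * g i (y j)| ≤ signDev g ε y :=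
      le_ciSup (f := fun i => |(1 / (n : ℝ)) * ∑ j, ((ε j : ℤ) : ℝ) * g i (y j)|)
        ⟨C, by rintro _ ⟨i, rfl⟩; exact h.abs_signMean_le ε i y⟩ i
    refine ciSup_le fun i => ?_
    simp only [mul_sub, Finset.sum_sub_distrib]
    exact (abs_sub _ _).trans (add_le_add (hb _ i) (hb _ i))
  have h1 : Integrable (fun q : (Fin n → E) × (Fin n → E) => signDev g ε q.1) (π.prod π) :=
    (h.integrable_signDev ε).comp_fst π
  have h2 : Integrable (fun q : (Fin n → E) × (Fin n → E) => signDev g ε q.2) (π.prod π) :=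
    (h.integrable_signDev ε).comp_snd π
  refine (integral_mono (h.integrable_ghostDev ε) (h2.add h1) hle).trans (le_of_eq ?_)
  rw [integral_add' h2 h1, integral_fun_fst, integral_fun_snd]
  simp [two_mul]

/-- Symmetrization. -/
lemma integral_uniformDev_le (h : IsBoundedFamily g Set.univ C c) (hn : 0 < n) :
    ∫ y, uniformDev P g y ∂(Measure.pi fun _ : Fin n => P) ≤ 2 * rademacher P g n := by
  have : Nonempty E := P.nonempty_of_neZero
  set π := Measure.pi fun _ : Fin n => P with hπ
  have h1 : ∫ y, uniformDev P g y ∂π ≤ ∫ q, ghostDev g 1 q ∂(π.prod π) := by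
    rw [integral_prod _ (h.integrable_ghostDev 1)]
    exact integral_mono (integrable_of_measurable_of_abs_le h.measurable_uniformDev
      h.abs_uniformDev_le) (h.integrable_ghostDev 1).integral_prod_left
      (h.uniformDev_le_integral_ghostDev hn)
  have h2 (ε : Fin n → ℤˣ) : ∫ q, ghostDev g 1 q ∂(π.prod π) ≤ 2 * ∫ y, signDev g ε y ∂π :=
    (h.integral_ghostDev_eq ε).trans_le (h.integral_ghostDev_le ε)
  have h3 : rademacher P g n = (1 / (2 : ℝ) ^ n) * ∑ ε : Fin n → ℤˣ, ∫ y, signDev g ε y ∂π := by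
    rw [← integral_finsetSum _ fun ε _ => h.integrable_signDev ε, ← integral_const_mul]
    rfl
  have h4 := Finset.sum_le_sum fun ε (_ : ε ∈ (Finset.univ : Finset (Fin n → ℤˣ))) => h2 ε
  rw [Finset.sum_const, Finset.card_univ, nsmul_eq_mul, ← Finset.mul_sum,
    show (Fintype.card (Fin n → ℤˣ) : ℝ) = 2 ^ n by simp] at h4
  refine h1.trans ?_
  rw [h3, ← mul_assoc, mul_comm (2 : ℝ), mul_assoc, one_div, inv_mul_eq_div,
    le_div_iff₀ (by positivity), mul_comm]
  exact h4

end Symmetrization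

end IsBoundedFamily

/-! ### Families controlled only on the support of the law -/

namespace IsBoundedFamily

variable {ι E : Type*} [TopologicalSpace ι] [MeasurableSpace E] {g : ι → E → ℝ} {s : Set E}
  {C : ℝ} {c : ℝ≥0}

/-- Precomposition with a map that sends every point outside s to one fixed point of s keeps all
bounds. It makes them global, as the bounded differences above require, though the data lie in the
ball only almost surely. -/
lemma exists_extension (h : IsBoundedFamily g s C c) (hs : MeasurableSet s) (hne : s.Nonempty) :
    ∃ g' : ι → E → ℝ, IsBoundedFamily g' Set.univ C c ∧ ∀ i, ∀ e ∈ s, g' i e = g i e := by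
  classical
  obtain ⟨e₀, he₀⟩ := hne
  let T : E → E := fun e => if e ∈ s then e else e₀
  have hT (e : E) : T e ∈ s := by
    by_cases he : e ∈ s
    · simp [T, he]
    · simpa [T, he] using he₀
  have hTm : Measurable T := Measurable.ite hs measurable_id measurable_const
  refine ⟨fun i e => g i (T e), ⟨fun i => (h.measurable i).comp hTm, fun e => h.continuous _,
    fun i e _ => h.bound i _ (hT e), fun i e _ e' _ => h.oscillation i _ (hT e) _ (hT e')⟩,
    fun i e he => ?_⟩
  simp [T, he]

end IsBoundedFamily

section Congr

variable {ι E : Type*} [MeasurableSpace E] {P : Measure E} [IsProbabilityMeasure P]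
  {g g' : ι → E → ℝ} {s : Set E} {n : ℕ}

lemma ae_pi_mem (hPs : ∀ᵐ e ∂P, e ∈ s) :
    ∀ᵐ y ∂(Measure.pi fun _ : Fin n => P), ∀ j, y j ∈ s :=
  ae_all_iff.2 fun j => (Measure.tendsto_eval_ae_ae (μ := fun _ : Fin n => P) (i := j)).eventually hPs

lemma uniformDev_congr (hPs : ∀ᵐ e ∂P, e ∈ s) (hg : ∀ i, ∀ e ∈ s, g' i e = g i e)
    {y : Fin n → E} (hy : ∀ j, y j ∈ s) : uniformDev P g' y = uniformDev P g y := by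
  unfold uniformDev
  congr 1
  funext i
  rw [integral_congr_ae (hPs.mono fun e he => hg i e he),
    Finset.sum_congr rfl fun j _ => hg i _ (hy j)]

lemma rademacher_congr (hPs : ∀ᵐ e ∂P, e ∈ s) (hg : ∀ i, ∀ e ∈ s, g' i e = g i e) :
    rademacher P g' n = rademacher P g n := by
  refine integral_congr_ae ((ae_pi_mem hPs).mono fun y hy => ?_)
  simp only [fun i j => hg i _ (hy j)]

lemma uniformDev_sub_const (hg : ∀ i, Integrable (g i) P) (hn : 0 < n) (a : ℝ) (y : Fin n → E) :
    uniformDev P (fun i e => g i e - a) y = uniformDev P g y := by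
  have hn' : (n : ℝ) ≠ 0 := (Nat.cast_pos.2 hn).ne'
  unfold uniformDev
  congr 1
  funext i
  rw [integral_sub (hg i) (integrable_const a), Finset.sum_sub_distrib]
  simp only [integral_const, probReal_univ, one_smul, Finset.sum_const, Finset.card_univ,
    Fintype.card_fin, nsmul_eq_mul]
  congr 1
  field_simp
  ring

lemma rademacher_le {r : ℝ} (hPs : ∀ᵐ e ∂P, e ∈ s)
    (h : ∀ y : Fin n → E, (∀ j, y j ∈ s) → (1 / (2 : ℝ) ^ n) * ∑ ε : Fin n → ℤˣ,
      ⨆ i, |(1 / (n : ℝ)) * ∑ j, ((ε j : ℤ) : ℝ) * g i (y j)| ≤ r) :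
    rademacher P g n ≤ r := by
  refine (le_abs_self _).trans (abs_integral_le_of_abs_le ((ae_pi_mem hPs).mono fun y hy => ?_))
  rw [abs_of_nonneg]
  · exact h y hy
  · exact mul_nonneg (by positivity)
      (Finset.sum_nonneg fun ε _ => Real.iSup_nonneg fun i => abs_nonneg _)

end Congr

namespace IsBoundedFamily

variable {ι E : Type*} [TopologicalSpace ι] [SecondCountableTopology ι] [Nonempty ι]
  [MeasurableSpace E] {P : Measure E} [IsProbabilityMeasure P] {g : ι → E → ℝ} {s : Set E}
  {C : ℝ} {c : ℝ≥0} {n : ℕ}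

lemma integral_uniformDev_le_of_ae (h : IsBoundedFamily g s C c) (hs : MeasurableSet s)
    (hPs : ∀ᵐ e ∂P, e ∈ s) (hn : 0 < n) :
    ∫ y, uniformDev P g y ∂(Measure.pi fun _ : Fin n => P) ≤ 2 * rademacher P g n := by
  obtain ⟨g', h', hg⟩ := h.exists_extension hs hPs.exists
  rw [← rademacher_congr hPs hg]
  refine le_trans (le_of_eq ?_) (h'.integral_uniformDev_le hn)
  exact integral_congr_ae ((ae_pi_mem hPs).mono fun y hy => (uniformDev_congr hPs hg hy).symm)

lemma measure_uniformDev_le (h : IsBoundedFamily g s C c) (hs : MeasurableSet s)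
    (hPs : ∀ᵐ e ∂P, e ∈ s) (hn : 0 < n) {δ r : ℝ} (hδ : 0 < δ) (hδ1 : δ < 1)
    (hr : ∫ y, uniformDev P g y ∂(Measure.pi fun _ : Fin n => P) ≤ r) :
    (Measure.pi fun _ : Fin n => P) {y | r + c * √(Real.log (1 / δ) / (2 * n)) < uniformDev P g y}
      ≤ ENNReal.ofReal δ := by
  obtain ⟨g', h', hg⟩ := h.exists_extension hs hPs.exists
  refine (measure_mono_ae ((ae_pi_mem hPs).mono fun y hy hlt => ?_)).trans
    (h'.measure_uniformDev_le_of_univ (P := P) hn hδ hδ1)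
  have h1 : ∫ y, uniformDev P g' y ∂(Measure.pi fun _ : Fin n => P)
      = ∫ y, uniformDev P g y ∂(Measure.pi fun _ : Fin n => P) :=
    integral_congr_ae ((ae_pi_mem hPs).mono fun y hy => uniformDev_congr hPs hg hy)
  change _ < uniformDev P g' y
  rw [uniformDev_congr hPs hg hy, h1]
  have h2 : r + c * √(Real.log (1 / δ) / (2 * n)) < uniformDev P g y := hlt
  linarith

lemma integrable_of_ae (h : IsBoundedFamily g s C c) (hPs : ∀ᵐ e ∂P, e ∈ s) (i : ι) :
    Integrable (g i) P :=
  Integrable.of_bound (h.measurable i).aestronglyMeasurable C (hPs.mono fun e he => h.bound i e he)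

end IsBoundedFamily

/-! ### Lipschitz losses of bounded scores -/

/-- A family of measurable scores in `[-Q, Q]`, continuous in the parameter. -/
structure IsScoreFamily {ι E : Type*} [TopologicalSpace ι] [MeasurableSpace E]
    (f : ι → E → ℝ) (s : Set E) (Q : ℝ≥0) : Prop where
  measurable : ∀ i, Measurable (f i)
  continuous : ∀ e, Continuous fun i => f i e
  bound : ∀ i, ∀ e ∈ s, |f i e| ≤ Q

namespace IsScoreFamily

variable {ι E : Type*} [TopologicalSpace ι] [MeasurableSpace E] {f : ι → E → ℝ} {s : Set E}
  {Q Λ : ℝ≥0} {F : ℝ → ℝ}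

lemma isBoundedFamily (h : IsScoreFamily f s Q) (hFc : Continuous F)
    (hF : LipschitzOnWith Λ F (Set.Icc (-Q) Q)) :
    IsBoundedFamily (fun i e => F (f i e)) s (|F 0| + Λ * Q) (2 * Λ * Q) where
  measurable i := hFc.measurable.comp (h.measurable i)
  continuous e := hFc.comp (h.continuous e)
  bound i e he := by
    have h1 := hF.dist_le_mul _ (abs_le.1 (h.bound i e he)) 0 (by simp)
    rw [Real.dist_eq, Real.dist_eq, sub_zero] at h1
    have h2 : (Λ : ℝ) * |f i e| ≤ Λ * Q := mul_le_mul_of_nonneg_left (h.bound i e he) Λ.2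
    have h3 := abs_sub_abs_le_abs_sub (F (f i e)) (F 0)
    linarith
  oscillation i e he e' he' := by
    have h1 := hF.dist_le_mul _ (abs_le.1 (h.bound i e he)) _ (abs_le.1 (h.bound i e' he'))
    rw [Real.dist_eq, Real.dist_eq] at h1
    refine h1.trans ?_
    have h2 := (abs_sub (f i e) (f i e')).trans (add_le_add (h.bound i e he) (h.bound i e' he'))
    have h3 := mul_le_mul_of_nonneg_left h2 (NNReal.coe_nonneg Λ)
    push_cast
    exact h3.trans (le_of_eq (by ring))

variable [SecondCountableTopology ι] [Nonempty ι] {P : Measure E} [IsProbabilityMeasure P] {n : ℕ}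

/-- Uniform deviations do not change when F 0 is subtracted, whereas Rademacher complexities with an
absolute value can. Centring before symmetrization makes contraction available and leaves no |F 0|
in the bound. -/
lemma integral_uniformDev_le_of_signAverage (h : IsScoreFamily f s Q) (hFc : Continuous F)
    (hF : LipschitzOnWith Λ F (Set.Icc (-Q) Q)) (hs : MeasurableSet s) (hPs : ∀ᵐ e ∂P, e ∈ s)
    (hn : 0 < n) {r : ℝ}
    (hr : ∀ G : ℝ → ℝ, LipschitzOnWith Λ G (Set.Icc (-Q) Q) → G 0 = 0 →
      ∀ y : Fin n → E, (∀ j, y j ∈ s) → (1 / (2 : ℝ) ^ n) * ∑ ε : Fin n → ℤˣ,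
        ⨆ i, |(1 / (n : ℝ)) * ∑ j, ((ε j : ℤ) : ℝ) * G (f i (y j))| ≤ r) :
    ∫ y, uniformDev P (fun i e => F (f i e)) y ∂(Measure.pi fun _ : Fin n => P) ≤ 2 * r := by
  have hG : LipschitzOnWith Λ (fun t => F t - F 0) (Set.Icc (-Q) Q) :=
    LipschitzOnWith.of_dist_le_mul fun x hx y hy => by
      rw [dist_sub_right]
      exact hF.dist_le_mul x hx y hy
  have h1 := (h.isBoundedFamily (hFc.sub continuous_const) hG).integral_uniformDev_le_of_ae
    hs hPs hn
  have h2 (y : Fin n → E) := uniformDev_sub_const (P := P) (g := fun i e => F (f i e))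
    ((h.isBoundedFamily hFc hF).integrable_of_ae hPs) hn (F 0) y
  refine (integral_congr_ae (ae_of_all _ fun y => (h2 y).symm)).trans_le (h1.trans ?_)
  refine mul_le_mul_of_nonneg_left ?_ two_pos.le
  exact rademacher_le hPs fun y hy => hr _ hG (sub_self _) y hy

end IsScoreFamily

/-! ### Continuity of the networks in parameters and inputs -/

namespace Arch

variable {A : Arch}

lemma continuous_linLayer {Y : Type*} [TopologicalSpace Y] {a b : ℕ}
    {V : Y → Matrix (Fin b) (Fin a) ℝ} (hV : Continuous V) {x : Y → EuclideanSpace ℝ (Fin a)}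
    (hx : Continuous x) : Continuous fun y => linLayer (V y) (x y) :=
  (PiLp.continuous_toLp 2 _).comp (hV.matrix_mulVec ((PiLp.continuous_ofLp 2 _).comp hx))

lemma continuous_hidden {Y : Type*} [TopologicalSpace Y] {K : ℕ} {a : ℕ → ℕ} {ρ : Fin K → ℝ → ℝ}
    (hρ : ∀ i, Continuous (ρ i)) {W : Y → ∀ i : Fin K, Matrix (Fin (a (i + 1))) (Fin (a i)) ℝ}
    (hW : Continuous W) {x : Y → EuclideanSpace ℝ (Fin (a 0))} (hx : Continuous x) (i : ℕ)
    (hi : i ≤ K) : Continuous fun y => hidden a ρ (W y) (x y) i hi := by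
  induction i with
  | zero => exact hx
  | succ i ih =>
    have h1 := continuous_linLayer ((continuous_apply (⟨i, hi⟩ : Fin K)).comp hW)
      (ih (Nat.le_of_succ_le hi))
    refine (PiLp.continuous_toLp 2 _).comp (continuous_pi fun j => ?_)
    exact (hρ _).comp ((continuous_apply j).comp ((PiLp.continuous_ofLp 2 _).comp h1))

instance : TopologicalSpace A.DParam :=
  TopologicalSpace.induced (fun ω => (ω.W, ω.w)) inferInstance

instance : TopologicalSpace A.GParam :=
  TopologicalSpace.induced (fun θ => (θ.V, θ.Vout)) inferInstance

instance {a b : ℕ} : SecondCountableTopology (Matrix (Fin a) (Fin b) ℝ) :=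
  inferInstanceAs (SecondCountableTopology (Fin a → Fin b → ℝ))

instance : SecondCountableTopology A.DParam :=
  TopologicalSpace.secondCountableTopology_induced _ _ _

instance : SecondCountableTopology A.GParam :=
  TopologicalSpace.secondCountableTopology_induced _ _ _

lemma continuous_DParam : Continuous fun ω : A.DParam => (ω.W, ω.w) := continuous_induced_dom

lemma continuous_GParam : Continuous fun θ : A.GParam => (θ.V, θ.Vout) := continuous_induced_dom

lemma continuous_preact {Y : Type*} [TopologicalSpace Y] {ω : Y → A.DParam} (hω : Continuous ω)
    {x : Y → A.Data} (hx : Continuous x) : Continuous fun y => preact (ω y) (x y) := by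
  have h := continuous_DParam.comp hω
  exact h.snd.inner (continuous_hidden (fun i => (A.r_lipschitz i).continuous) h.fst hx _ _)

lemma continuous_gen {Y : Type*} [TopologicalSpace Y] {θ : Y → A.GParam} (hθ : Continuous θ)
    {z : Y → A.Latent} (hz : Continuous z) : Continuous fun y => gen (θ y) (z y) := by
  have h := continuous_GParam.comp hθ
  exact continuous_linLayer h.snd
    (continuous_hidden (fun i => (A.s_lipschitz i).continuous) h.fst hz _ _)

instance : Nonempty A.discSet :=
  ⟨⟨⟨fun _ => 0, 0⟩, fun i => by rw [frobNorm_zero]; positivity, by simp⟩⟩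

instance : Nonempty A.genSet :=
  ⟨⟨⟨fun _ => 0, 0⟩, fun i => by rw [frobNorm_zero]; positivity, by rw [frobNorm_zero]; positivity⟩⟩

lemma Qx_nonneg {B : ℝ} (hB : 0 ≤ B) : 0 ≤ A.Qx B := mul_nonneg discConst_nonneg hB

lemma Qz_eq (B : ℝ) : A.Qz B = A.discConst * (A.genConst * B) := by
  rw [Qz, discConst, genConst, mul_assoc]

lemma Qz_nonneg {B : ℝ} (hB : 0 ≤ B) : 0 ≤ A.Qz B := by
  rw [Qz_eq]
  exact mul_nonneg discConst_nonneg (mul_nonneg genConst_nonneg hB)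

lemma abs_preact_gen_le {ω : A.DParam} (hω : ω ∈ A.discSet) {θ : A.GParam} (hθ : θ ∈ A.genSet)
    {z : A.Latent} {B : ℝ} (hz : ‖z‖ ≤ B) : |preact ω (gen θ z)| ≤ A.Qz B := by
  rw [Qz_eq]
  exact abs_preact_le hω (norm_gen_le hθ hz)

lemma isScoreFamily_preact {B : ℝ} (hB : 0 ≤ B) :
    IsScoreFamily (fun (ω : A.discSet) (x : A.Data) => preact ω.1 x) {x | ‖x‖ ≤ B}
      (A.Qx B).toNNReal where
  measurable ω := (continuous_preact continuous_const continuous_id).measurable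
  continuous x := continuous_preact continuous_subtype_val continuous_const
  bound ω x hx := by
    rw [Real.coe_toNNReal _ (Qx_nonneg hB)]
    exact abs_preact_le ω.2 hx

lemma isScoreFamily_preact_gen {B : ℝ} (hB : 0 ≤ B) :
    IsScoreFamily (fun (q : A.discSet × A.genSet) (z : A.Latent) => preact q.1.1 (gen q.2.1 z))
      {z | ‖z‖ ≤ B} (A.Qz B).toNNReal where
  measurable q := (continuous_preact continuous_const
    (continuous_gen continuous_const continuous_id)).measurable
  continuous z := continuous_preact (continuous_subtype_val.comp continuous_fst)
    (continuous_gen (continuous_subtype_val.comp continuous_snd) continuous_const)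
  bound q z hz := by
    rw [Real.coe_toNNReal _ (Qz_nonneg hB)]
    exact abs_preact_gen_le q.1.2 q.2.2 hz

end Arch

open Arch

/-! ### Lipschitz constants of the α-loss composed with the sigmoid -/

section AlphaLoss

/-- Weighted AM-GM for p / v and (1 - p) / w, whose weighted mean is 1, raised to the power 1 / w.
Equality holds at p = v. -/
lemma rpow_mul_one_sub_le {v w p : ℝ} (hv : 0 < v) (hw : 0 < w) (hvw : v + w = 1)
    (hp : 0 < p) (hp1 : p < 1) : p ^ (v / w) * (1 - p) ≤ v ^ (v / w) * w := by
  have hq : 0 < 1 - p := sub_pos.2 hp1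
  have h1 := Real.geom_mean_le_arith_mean2_weighted hv.le hw.le (div_pos hp hv).le
    (div_pos hq hw).le hvw
  rw [mul_div_cancel₀ _ hv.ne', mul_div_cancel₀ _ hw.ne', add_sub_cancel] at h1
  have h2 := Real.rpow_le_rpow (by positivity) h1 (one_div_pos.2 hw).le
  rw [Real.one_rpow, Real.mul_rpow (by positivity) (by positivity), ← Real.rpow_mul (by positivity),
    ← Real.rpow_mul (by positivity), mul_one_div, mul_one_div_cancel hw.ne', Real.rpow_one,
    Real.div_rpow hp.le hv.le, div_mul_div_comm, div_le_one (by positivity)] at h2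
  exact h2

/-- The exponent `(α - 1) / α`. -/
noncomputable def alphaExponent (α : ℝ≥0∞) : ℝ :=
  if α = ⊤ then 1 else (α.toReal - 1) / α.toReal

lemma toReal_pos_of_pos {α : ℝ≥0∞} (hα : 0 < α) (hα' : α ≠ ⊤) : 0 < α.toReal :=
  ENNReal.toReal_pos hα.ne' hα'

lemma toReal_ne_one {α : ℝ≥0∞} (h1 : α ≠ 1) : α.toReal ≠ 1 := fun h =>
  h1 ((ENNReal.toReal_eq_one_iff α).1 h)

lemma hasDerivAt_alphaLossOne {α : ℝ≥0∞} (hα : 0 < α) {p : ℝ} (hp : 0 < p) :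
    HasDerivAt (fun p => -alphaLossOne α p) (p ^ (alphaExponent α - 1)) p := by
  unfold alphaLossOne alphaExponent
  split_ifs with h h1
  · rw [sub_self, Real.rpow_zero]
    simpa using hasDerivAt_id' p
  · subst h1
    simpa [Real.rpow_neg_one] using Real.hasDerivAt_log hp.ne'
  · have ha := toReal_pos_of_pos hα h
    have ha1 : α.toReal - 1 ≠ 0 := sub_ne_zero.2 (toReal_ne_one h1)
    refine (((Real.hasDerivAt_rpow_const (p := (α.toReal - 1) / α.toReal)
      (Or.inl hp.ne')).const_sub 1).const_mul (α.toReal / (α.toReal - 1))).neg.congr_deriv ?_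
    generalize p ^ ((α.toReal - 1) / α.toReal - 1) = u
    field_simp

lemma hasDerivAt_alphaLossOne_sigmoid {α : ℝ≥0∞} (hα : 0 < α) (t : ℝ) :
    HasDerivAt (fun t => -alphaLossOne α (Real.sigmoid t))
      (Real.sigmoid t ^ alphaExponent α * (1 - Real.sigmoid t)) t := by
  refine ((hasDerivAt_alphaLossOne hα (Real.sigmoid_pos t)).comp t
    (Real.hasDerivAt_sigmoid t)).congr_deriv ?_
  rw [← mul_assoc, ← Real.rpow_add_one (Real.sigmoid_pos t).ne', sub_add_cancel]

/-- For α ≤ 1 the exponent is nonpositive, so both factors decrease in t and the maximum sits at t =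
-h, where 1 - σ(-h) = σ(h). For larger α the bound is the global maximum over p = σ(t) in (0, 1). -/
lemma sigmoid_rpow_mul_le_clipConst {α : ℝ≥0∞} (hα : 0 < α) {h t : ℝ} (ht : -h ≤ t) :
    Real.sigmoid t ^ alphaExponent α * (1 - Real.sigmoid t) ≤ clipConst α h := by
  have h0 := Real.sigmoid_pos t
  have h1 := Real.sigmoid_lt_one t
  unfold alphaExponent clipConst
  split_ifs with h2 h3
  · rw [Real.rpow_one]
    nlinarith [sq_nonneg (Real.sigmoid t - 1 / 2)]
  · have ha := toReal_pos_of_pos hα h2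
    have ha1 : α.toReal ≤ 1 := ENNReal.toReal_le_of_le_ofReal one_pos.le (by simpa using h3)
    have h4 : Real.sigmoid (-h) ≤ Real.sigmoid t := Real.sigmoid_le ht
    have h5 := Real.rpow_le_rpow_of_nonpos (Real.sigmoid_pos (-h)) h4
      (div_nonpos_of_nonpos_of_nonneg (sub_nonpos.2 ha1) ha.le)
    rw [mul_comm]
    refine mul_le_mul ?_ h5 (Real.rpow_nonneg h0.le _) (Real.sigmoid_pos h).le
    rw [Real.sigmoid_neg] at h4
    linarith
  · have ha : 1 < α.toReal := by
      have := (ENNReal.toReal_lt_toReal ENNReal.one_ne_top h2).2 (not_le.1 h3)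
      rwa [ENNReal.toReal_one] at this
    have h4 : 0 < 2 * α.toReal - 1 := by linarith
    have h5 := rpow_mul_one_sub_le (v := (α.toReal - 1) / (2 * α.toReal - 1))
      (w := α.toReal / (2 * α.toReal - 1)) (div_pos (by linarith) h4) (div_pos (by linarith) h4)
      (by rw [← add_div, div_eq_one_iff_eq h4.ne']; ring) h0 h1
    rwa [div_div_div_cancel_right₀ h4.ne'] at h5

lemma clipConst_nonneg {α : ℝ≥0∞} (hα : 0 < α) (h : ℝ) : 0 ≤ clipConst α h :=
  (mul_nonneg (Real.rpow_nonneg (Real.sigmoid_nonneg _) _)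
    (sub_nonneg.2 (Real.sigmoid_le_one _))).trans (sigmoid_rpow_mul_le_clipConst hα le_rfl)

lemma lipschitzOnWith_alphaLossOne_sigmoid {α : ℝ≥0∞} (hα : 0 < α) (h : ℝ) :
    LipschitzOnWith (clipConst α h).toNNReal (fun t => -alphaLossOne α (Real.sigmoid t))
      (Set.Icc (-h) h) := by
  refine (convex_Icc (-h) h).lipschitzOnWith_of_nnnorm_hasDerivWithin_le
    (fun t _ => (hasDerivAt_alphaLossOne_sigmoid hα t).hasDerivWithinAt) fun t ht => ?_
  rw [← NNReal.coe_le_coe, coe_nnnorm, Real.coe_toNNReal _ (clipConst_nonneg hα h),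
    Real.norm_of_nonneg (mul_nonneg (Real.rpow_nonneg (Real.sigmoid_nonneg _) _)
      (sub_nonneg.2 (Real.sigmoid_le_one _)))]
  exact sigmoid_rpow_mul_le_clipConst hα ht.1

lemma lipschitzOnWith_alphaLoss_sigmoid {α : ℝ≥0∞} (hα : 0 < α) (h : ℝ) (y : Fin 2) :
    LipschitzOnWith (clipConst α h).toNNReal (fun t => -alphaLoss α y (Real.sigmoid t))
      (Set.Icc (-h) h) := by
  have h1 := lipschitzOnWith_alphaLossOne_sigmoid hα h
  unfold alphaLoss
  split_ifs
  · exact h1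
  -- 1 - σ(t) = σ(-t) reduces the label 0 to the label 1, and [-h, h] is symmetric.
  · simp only [← Real.sigmoid_neg]
    refine LipschitzOnWith.of_dist_le_mul fun t ht s hs => ?_
    have := h1.dist_le_mul (-t) ⟨by linarith [ht.2], by linarith [ht.1]⟩ (-s)
      ⟨by linarith [hs.2], by linarith [hs.1]⟩
    rwa [dist_neg_neg t s] at this

lemma continuousOn_alphaLoss {α : ℝ≥0∞} (hα : 0 < α) (y : Fin 2) :
    ContinuousOn (alphaLoss α y) (Set.Ioo 0 1) := by
  have h1 : ContinuousOn (alphaLossOne α) (Set.Ioo 0 1) := by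
    have : ContinuousOn (fun p => -alphaLossOne α p) (Set.Ioo 0 1) := fun p hp =>
      (hasDerivAt_alphaLossOne hα hp.1).continuousAt.continuousWithinAt
    exact this.neg.congr fun p _ => (neg_neg _).symm
  unfold alphaLoss
  split_ifs
  · exact h1
  · exact h1.comp (by fun_prop) fun p hp => ⟨by linarith [hp.2], by linarith [hp.1]⟩

lemma lipschitzWith_sigmoid : LipschitzWith (1 / 4) Real.sigmoid := by
  refine lipschitzWith_of_nnnorm_deriv_le differentiable_sigmoid fun t => ?_
  rw [← NNReal.coe_le_coe, coe_nnnorm, Real.deriv_sigmoid, Real.norm_of_nonneg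
    (mul_nonneg (Real.sigmoid_nonneg _) (sub_nonneg.2 (Real.sigmoid_le_one _)))]
  push_cast
  nlinarith [sq_nonneg (Real.sigmoid t - 1 / 2)]

lemma sigmoid_mem_Ioo (t : ℝ) : Real.sigmoid t ∈ Set.Ioo (0 : ℝ) 1 :=
  ⟨Real.sigmoid_pos t, Real.sigmoid_lt_one t⟩

lemma lipschitzWith_comp_sigmoid {φ : ℝ → ℝ} {Λ : ℝ≥0} (hφ : LipschitzOnWith Λ φ (Set.Ioo 0 1)) :
    LipschitzWith (Λ * (1 / 4)) fun t => φ (Real.sigmoid t) :=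
  lipschitzOnWith_univ.1 (hφ.comp (lipschitzWith_sigmoid.lipschitzOnWith (s := Set.univ))
    fun t _ => sigmoid_mem_Ioo t)

end AlphaLoss

/-! ### Estimation error of the trained generator -/

lemma integral_empirical {E : Type*} [MeasurableSpace E] [MeasurableSingletonClass E] {n : ℕ}
    (x : Fin n → E) (f : E → ℝ) :
    ∫ e, f e ∂(empirical x) = (1 / (n : ℝ)) * ∑ j, f (x j) := by
  rw [empirical, integral_smul_measure, integral_finsetSum_measure fun j _ =>
    integrable_dirac (by simp)]
  simp

lemma abs_dev_le_uniformDev {ι E : Type*} [MeasurableSpace E] {P : Measure E}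
    [IsProbabilityMeasure P] {g : ι → E → ℝ} {s : Set E} {C : ℝ} (hC : ∀ i, ∀ e ∈ s, |g i e| ≤ C)
    (hPs : ∀ᵐ e ∂P, e ∈ s) {n : ℕ} {y : Fin n → E} (hy : ∀ j, y j ∈ s) (i : ι) :
    |(∫ e, g i e ∂P) - (1 / (n : ℝ)) * ∑ j, g i (y j)| ≤ uniformDev P g y := by
  refine le_ciSup (f := fun i => |(∫ e, g i e ∂P) - (1 / (n : ℝ)) * ∑ j, g i (y j)|)
    ⟨C + C, ?_⟩ i
  rintro _ ⟨i, rfl⟩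
  obtain ⟨e, he⟩ := hPs.exists
  exact (abs_sub _ _).trans (add_le_add
    (abs_integral_le_of_abs_le (hPs.mono fun e he => hC i e he))
    (abs_mean_le ((abs_nonneg _).trans (hC i e he)) fun j => hC i _ (hy j)))

lemma nonneg_of_ae_norm_le {E : Type*} [MeasurableSpace E] [NormedAddCommGroup E] {P : Measure E}
    [IsProbabilityMeasure P] {B : ℝ} (hB : ∀ᵐ x ∂P, ‖x‖ ≤ B) : 0 ≤ B :=
  let ⟨_, hx⟩ := hB.exists
  (norm_nonneg _).trans hx

section Gan

variable {A : Arch} {Pr : Measure A.Data} [IsProbabilityMeasure Pr] {PZ : Measure A.Latent}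
  [IsProbabilityMeasure PZ] {Bx Bz : ℝ} {ℓG : Fin 2 → ℝ → ℝ}

lemma continuous_neg_loss_sigmoid (hℓ : ∀ y, ContinuousOn (ℓG y) (Set.Ioo 0 1)) (y : Fin 2) :
    Continuous fun t => -ℓG y (Real.sigmoid t) :=
  ((hℓ y).comp_continuous continuous_sigmoid sigmoid_mem_Ioo).neg

lemma value_genLaw_eq (hℓ : ∀ y, ContinuousOn (ℓG y) (Set.Ioo 0 1)) (P : Measure A.Data)
    (Q : Measure A.Latent) (ω : A.DParam) (θ : A.GParam) :
    value ℓG ω P (genLaw Q θ)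
      = (∫ x, -ℓG 1 (disc ω x) ∂P) + ∫ z, -ℓG 0 (disc ω (gen θ z)) ∂Q := by
  have h1 : Continuous fun x => -ℓG 0 (disc ω x) := (continuous_neg_loss_sigmoid hℓ 0).comp
    (continuous_preact continuous_const continuous_id)
  have h2 : Continuous (gen θ) := continuous_gen continuous_const continuous_id
  rw [value, genLaw, integral_map h2.measurable.aemeasurable h1.aestronglyMeasurable]

theorem estError_le_uniformDev {ωs : A.GParam → A.DParam}
    (hBx : ∀ᵐ x ∂Pr, ‖x‖ ≤ Bx) (hBz : ∀ᵐ z ∂PZ, ‖z‖ ≤ Bz)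
    (hℓ : ∀ y, ContinuousOn (ℓG y) (Set.Ioo 0 1)) (hωs : ∀ θ ∈ A.genSet, ωs θ ∈ A.discSet)
    {n m : ℕ} {x : Fin n → A.Data} (hx : ∀ i, ‖x i‖ ≤ Bx) {z : Fin m → A.Latent}
    (hz : ∀ j, ‖z j‖ ≤ Bz) {θ : A.GParam} (hθ : IsTrainedGen ℓG ωs x z θ) :
    estError ℓG ωs Pr PZ θ ≤ 2 * uniformDev Pr (discFamily A fun t => -ℓG 1 t) x
      + 2 * uniformDev PZ (discGenFamily A fun t => -ℓG 0 t) z := by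
  have hF := continuous_neg_loss_sigmoid hℓ
  -- Boundedness of the losses on the compact score ranges makes the suprema genuine; an unbounded
  -- real supremum would be 0 by default.
  obtain ⟨Cx, hCx⟩ := (isCompact_Icc (a := -A.Qx Bx) (b := A.Qx Bx)).exists_bound_of_continuousOn
    (hF 1).continuousOn
  obtain ⟨Cz, hCz⟩ := (isCompact_Icc (a := -A.Qz Bz) (b := A.Qz Bz)).exists_bound_of_continuousOn
    (hF 0).continuousOn
  have hdev (θ' : A.GParam) (hθ' : θ' ∈ A.genSet) :
      |value ℓG (ωs θ') Pr (genLaw PZ θ')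
        - value ℓG (ωs θ') (empirical x) (genLaw (empirical z) θ')|
      ≤ uniformDev Pr (discFamily A fun t => -ℓG 1 t) x
        + uniformDev PZ (discGenFamily A fun t => -ℓG 0 t) z := by
    have h1 := abs_dev_le_uniformDev (g := discFamily A fun t => -ℓG 1 t) (s := {x | ‖x‖ ≤ Bx})
      (fun ω e he => hCx _ (abs_le.1 (abs_preact_le ω.2 he))) hBx hx ⟨_, hωs θ' hθ'⟩
    have h2 := abs_dev_le_uniformDev (g := discGenFamily A fun t => -ℓG 0 t)
      (s := {z | ‖z‖ ≤ Bz}) (fun q e he => hCz _ (abs_le.1 (abs_preact_gen_le q.1.2 q.2.2 he)))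
      hBz hz (⟨_, hωs θ' hθ'⟩, ⟨θ', hθ'⟩)
    rw [value_genLaw_eq hℓ, value_genLaw_eq hℓ, integral_empirical, integral_empirical,
      add_sub_add_comm]
    exact (abs_add_le _ _).trans (add_le_add h1 h2)
  set U := uniformDev Pr (discFamily A fun t => -ℓG 1 t) x
  set V := uniformDev PZ (discGenFamily A fun t => -ℓG 0 t) z
  have hinf : value ℓG (ωs θ) Pr (genLaw PZ θ) - (2 * U + 2 * V)
      ≤ ⨅ θ' : A.genSet, value ℓG (ωs θ') Pr (genLaw PZ θ') := by
    refine le_ciInf fun θ' => ?_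
    have h1 := (abs_le.1 (hdev θ hθ.1)).2
    have h2 := (abs_le.1 (hdev θ' θ'.2)).1
    have h3 : value ℓG (ωs θ) (empirical x) (genLaw (empirical z) θ)
        ≤ value ℓG (ωs θ') (empirical x) (genLaw (empirical z) θ') := hθ.2 θ'.2
    linarith
  unfold estError
  linarith

variable {S : Type*} [MeasurableSpace S] {μ : Measure S} [IsProbabilityMeasure μ] {n m : ℕ}

/-- Only an inequality is available since s need not be measurable, but it is the direction needed
for outer measures. -/
lemma measure_sample_le {E : Type*} [MeasurableSpace E] {P : Measure E} {X : Fin n → S → E}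
    (hX : ∀ i, HasLaw (X i) P μ) (hXind : iIndepFun X μ) (s : Set (Fin n → E)) :
    μ {t | (fun i => X i t) ∈ s} ≤ (Measure.pi fun _ : Fin n => P) s := by
  have h1 := (iIndepFun_iff_map_fun_eq_pi_map fun i => (hX i).aemeasurable).1 hXind
  simp only [fun i => (hX i).map_eq] at h1
  rw [← h1]
  exact Measure.le_map_apply (aemeasurable_pi_lambda _ fun i => (hX i).aemeasurable) s

lemma ae_sample_norm_le {E : Type*} [MeasurableSpace E] [NormedAddCommGroup E] {P : Measure E}
    {X : Fin n → S → E} (hX : ∀ i, HasLaw (X i) P μ) {B : ℝ} (hB : ∀ᵐ x ∂P, ‖x‖ ≤ B) :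
    ∀ᵐ t ∂μ, ∀ i, ‖X i t‖ ≤ B :=
  ae_all_iff.2 fun i => ae_of_ae_map (hX i).aemeasurable ((hX i).map_eq ▸ hB)

lemma errorBoundWithFailure_of_tails {ωs : A.GParam → A.DParam}
    (hBx : ∀ᵐ x ∂Pr, ‖x‖ ≤ Bx) (hBz : ∀ᵐ z ∂PZ, ‖z‖ ≤ Bz)
    (hℓ : ∀ y, ContinuousOn (ℓG y) (Set.Ioo 0 1)) (hωs : ∀ θ ∈ A.genSet, ωs θ ∈ A.discSet)
    {X : Fin n → S → A.Data} (hX : ∀ i, HasLaw (X i) Pr μ) (hXind : iIndepFun X μ)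
    {Z : Fin m → S → A.Latent} (hZ : ∀ j, HasLaw (Z j) PZ μ) (hZind : iIndepFun Z μ)
    {δ a b c : ℝ} (hδ : 0 < δ)
    (ha : (Measure.pi fun _ : Fin n => Pr) {y | a < uniformDev Pr (discFamily A fun t => -ℓG 1 t) y}
      ≤ ENNReal.ofReal δ)
    (hb : (Measure.pi fun _ : Fin m => PZ)
      {y | b < uniformDev PZ (discGenFamily A fun t => -ℓG 0 t) y} ≤ ENNReal.ofReal δ)
    (hc : 2 * a + 2 * b = c) :
    ErrorBoundWithFailure μ ℓG ωs Pr PZ X Z (2 * δ) c := by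
  have hsub : {t | ∃ θ, IsTrainedGen ℓG ωs (fun i => X i t) (fun j => Z j t) θ ∧
        c < estError ℓG ωs Pr PZ θ}
      ≤ᵐ[μ] ({t | (fun i => X i t) ∈ {y | a < uniformDev Pr (discFamily A fun t => -ℓG 1 t) y}}
        ∪ {t | (fun j => Z j t) ∈ {y | b < uniformDev PZ (discGenFamily A fun t => -ℓG 0 t) y}}
          : Set S) := by
    filter_upwards [ae_sample_norm_le hX hBx, ae_sample_norm_le hZ hBz] with t htx htz
    rintro ⟨θ, hθ, hlt⟩
    have h1 := estError_le_uniformDev hBx hBz hℓ hωs htx htz hθ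
    by_contra hnot
    have hnot' : ¬ (a < uniformDev Pr (discFamily A fun t => -ℓG 1 t) (fun i => X i t)
      ∨ b < uniformDev PZ (discGenFamily A fun t => -ℓG 0 t) (fun j => Z j t)) := hnot
    push Not at hnot'
    linarith [hnot'.1, hnot'.2]
  unfold ErrorBoundWithFailure
  refine (measure_mono_ae hsub).trans ((measure_union_le _ _).trans ?_)
  rw [two_mul, ENNReal.ofReal_add hδ.le hδ.le]
  exact add_le_add ((measure_sample_le hX hXind _).trans ha) ((measure_sample_le hZ hZind _).trans hb)

lemma four_mul_mul_sqrt_eq (a : ℝ) {L : ℝ} (hL : 0 ≤ L) {n : ℕ} :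
    2 * (2 * a * √(L / (2 * n))) = 2 * √(2 * L) * (a / √n) := by
  rw [show L / (2 * (n : ℝ)) = 2 * L / (2 ^ 2 * n) by
    rw [show (2 : ℝ) ^ 2 * n = 2 * (2 * n) by ring, mul_div_mul_left _ _ two_ne_zero],
    Real.sqrt_div (mul_nonneg two_pos.le hL), Real.sqrt_mul (sq_nonneg (2 : ℝ)),
    Real.sqrt_sq two_pos.le]
  ring

/-- Error bounds when the losses composed with the sigmoid are Lipschitz on the ranges of the
networks. -/
theorem errorBoundWithFailure_of_lipschitz {ωs : A.GParam → A.DParam}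
    (hBx : ∀ᵐ x ∂Pr, ‖x‖ ≤ Bx) (hBz : ∀ᵐ z ∂PZ, ‖z‖ ≤ Bz)
    (hℓ : ∀ y, ContinuousOn (ℓG y) (Set.Ioo 0 1)) (hωs : ∀ θ ∈ A.genSet, ωs θ ∈ A.discSet)
    {X : Fin n → S → A.Data} (hX : ∀ i, HasLaw (X i) Pr μ) (hXind : iIndepFun X μ)
    {Z : Fin m → S → A.Latent} (hZ : ∀ j, HasLaw (Z j) PZ μ) (hZind : iIndepFun Z μ)
    (hn : 0 < n) (hm : 0 < m) {Λ Λ' : ℝ≥0}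
    (hφ : LipschitzOnWith Λ (fun t => -ℓG 1 (Real.sigmoid t)) (Set.Icc (-A.Qx Bx) (A.Qx Bx)))
    (hψ : LipschitzOnWith Λ' (fun t => -ℓG 0 (Real.sigmoid t)) (Set.Icc (-A.Qz Bz) (A.Qz Bz)))
    {δ : ℝ} (hδ : 0 < δ) (hδ1 : δ < 1) :
    ErrorBoundWithFailure μ ℓG ωs Pr PZ X Z (2 * δ)
        (4 * rademacher Pr (discFamily A fun t => -ℓG 1 t) n
          + 4 * rademacher PZ (discGenFamily A fun t => -ℓG 0 t) m
          + 2 * √(2 * Real.log (1 / δ)) * (Λ * A.Qx Bx / √n + Λ' * A.Qz Bz / √m))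
      ∧ ErrorBoundWithFailure μ ℓG ωs Pr PZ X Z (2 * δ)
        (4 * (Λ * A.Qx Bx * √(3 * ((A.K : ℝ) + 1)) / √n)
          + 4 * (Λ' * A.Qz Bz * √(3 * ((A.K : ℝ) + 1 + (A.L + 1) - 1)) / √m)
          + 2 * √(2 * Real.log (1 / δ)) * (Λ * A.Qx Bx / √n + Λ' * A.Qz Bz / √m)) := by
  have hBx0 := nonneg_of_ae_norm_le hBx
  have hBz0 := nonneg_of_ae_norm_le hBz
  have hQx := Real.coe_toNNReal _ (A.Qx_nonneg hBx0)
  have hQz := Real.coe_toNNReal _ (A.Qz_nonneg hBz0)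
  have hsx : MeasurableSet {x : A.Data | ‖x‖ ≤ Bx} := measurableSet_le measurable_norm measurable_const
  have hsz : MeasurableSet {z : A.Latent | ‖z‖ ≤ Bz} :=
    measurableSet_le measurable_norm measurable_const
  have hlog : 0 < Real.log (1 / δ) := Real.log_pos (by rwa [lt_div_iff₀ hδ, one_mul])
  have hx := A.isScoreFamily_preact hBx0
  have hz := A.isScoreFamily_preact_gen hBz0
  have hφ' := hφ
  have hψ' := hψ
  rw [← hQx] at hφ'
  rw [← hQz] at hψ'
  have hbx : IsBoundedFamily (discFamily A fun t => -ℓG 1 t) _ _ _ :=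
    hx.isBoundedFamily (continuous_neg_loss_sigmoid hℓ 1) hφ'
  have hbz : IsBoundedFamily (discGenFamily A fun t => -ℓG 0 t) _ _ _ :=
    hz.isBoundedFamily (continuous_neg_loss_sigmoid hℓ 0) hψ'
  constructor
  · refine errorBoundWithFailure_of_tails hBx hBz hℓ hωs hX hXind hZ hZind hδ
      (hbx.measure_uniformDev_le hsx hBx hn hδ hδ1 (hbx.integral_uniformDev_le_of_ae hsx hBx hn))
      (hbz.measure_uniformDev_le hsz hBz hm hδ hδ1 (hbz.integral_uniformDev_le_of_ae hsz hBz hm)) ?_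
    push_cast
    rw [hQx, hQz, mul_add (2 * √(2 * Real.log (1 / δ))), ← four_mul_mul_sqrt_eq _ hlog.le,
      ← four_mul_mul_sqrt_eq _ hlog.le]
    ring
  · have hix := hx.integral_uniformDev_le_of_signAverage (P := Pr)
      (continuous_neg_loss_sigmoid hℓ 1) hφ' hsx hBx hn fun G hG hG0 y hy =>
        signAverage_disc_le hn hBx0 (by rwa [hQx] at hG) hG0 y hy
    have hiz := hz.integral_uniformDev_le_of_signAverage (P := PZ)
      (continuous_neg_loss_sigmoid hℓ 0) hψ' hsz hBz hm fun G hG hG0 y hy =>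
        signAverage_discGen_le hm hBz0 (by rwa [hQz] at hG) hG0 y hy
    refine errorBoundWithFailure_of_tails hBx hBz hℓ hωs hX hXind hZ hZind hδ
      (hbx.measure_uniformDev_le hsx hBx hn hδ hδ1 hix)
      (hbz.measure_uniformDev_le hsz hBz hm hδ hδ1 hiz) ?_
    push_cast
    rw [hQx, hQz, mul_add (2 * √(2 * Real.log (1 / δ))), ← four_mul_mul_sqrt_eq _ hlog.le,
      ← four_mul_mul_sqrt_eq _ hlog.le]
    ring

/-- Absorbs the factor 1/4 from the Lipschitz constant of the sigmoid. -/
lemma two_mul_sqrt_mul_quarter_eq {L : ℝ} (a : ℝ) (n : ℕ) :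
    2 * √(2 * L) * (a * (1 / 4) / √n) = √L * (a / √(2 * n)) := by
  rw [Real.sqrt_mul two_pos.le, Real.sqrt_mul two_pos.le]
  have h : √(2 : ℝ) ≠ 0 := (Real.sqrt_pos.2 two_pos).ne'
  have h2 : √(2 : ℝ) * √2 = 2 := Real.mul_self_sqrt two_pos.le
  have h3 : a / √2 = a * √2 / 2 := by
    rw [div_eq_div_iff h two_ne_zero, mul_assoc, h2]
  rw [div_mul_eq_div_div a, h3]
  ring

end Gan

end DualGAN

/-! ### The main theorem -/

open DualGAN DualGAN.Arch in
theorem mainTheorem12 (A : DualGAN.Arch)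
    (Pr : Measure A.Data) [IsProbabilityMeasure Pr]
    (PZ : Measure A.Latent) [IsProbabilityMeasure PZ]
    (Bx Bz : ℝ) (hBx : ∀ᵐ x ∂Pr, ‖x‖ ≤ Bx) (hBz : ∀ᵐ z ∂PZ, ‖z‖ ≤ Bz)
    (n m : ℕ) (hn : 0 < n) (hm : 0 < m)
    {S : Type*} [MeasurableSpace S] (μ : Measure S) [IsProbabilityMeasure μ]
    (X : Fin n → S → A.Data) (hX : ∀ i, HasLaw (X i) Pr μ) (hXind : iIndepFun X μ)
    (Z : Fin m → S → A.Latent) (hZ : ∀ j, HasLaw (Z j) PZ μ) (hZind : iIndepFun Z μ) :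
    -- the estimation error is bounded by the uniform deviations, for every pair of samples
    (∀ (ℓD ℓG : Fin 2 → ℝ → ℝ),
      (∀ y, ContinuousOn (ℓG y) (Set.Ioo 0 1)) →
      ∀ ωs : A.GParam → A.DParam, IsOptimalDisc ℓD Pr PZ ωs →
      ∀ x : Fin n → A.Data, (∀ i, ‖x i‖ ≤ Bx) →
      ∀ z : Fin m → A.Latent, (∀ j, ‖z j‖ ≤ Bz) →
      ∀ θ, IsTrainedGen ℓG ωs x z θ →
        estError ℓG ωs Pr PZ θ
          ≤ 2 * uniformDev Pr (discFamily A fun t => -ℓG 1 t) x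
            + 2 * uniformDev PZ (discGenFamily A fun t => -ℓG 0 t) z)
    -- high-probability bounds for Lipschitz losses
    ∧ (∀ (ℓD ℓG : Fin 2 → ℝ → ℝ) (Lφ Lψ : ℝ≥0),
      LipschitzOnWith Lφ (fun t => -ℓG 1 t) (Set.Ioo 0 1) →
      LipschitzOnWith Lψ (fun t => -ℓG 0 t) (Set.Ioo 0 1) →
      ∀ ωs : A.GParam → A.DParam, IsOptimalDisc ℓD Pr PZ ωs →
      ∀ δ : ℝ, 0 < δ → δ < 1 →
        ErrorBoundWithFailure μ ℓG ωs Pr PZ X Z (2 * δ)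
          (4 * rademacher Pr (discFamily A fun t => -ℓG 1 t) n
            + 4 * rademacher PZ (discGenFamily A fun t => -ℓG 0 t) m
            + √(Real.log (1 / δ))
              * (Lφ * A.Qx Bx / √(2 * n) + Lψ * A.Qz Bz / √(2 * m)))
        ∧ ErrorBoundWithFailure μ ℓG ωs Pr PZ X Z (2 * δ)
          (Lφ * A.Qx Bx * √(3 * ((A.K : ℝ) + 1)) / √n
            + Lψ * A.Qz Bz * √(3 * ((A.K : ℝ) + 1 + (A.L + 1) - 1)) / √m
            + √(Real.log (1 / δ))
              * (Lφ * A.Qx Bx / √(2 * n) + Lψ * A.Qz Bz / √(2 * m))))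
    -- specialization to the tunable losses of the discriminator and of the generator
    ∧ (∀ αD αG : ℝ≥0∞, 0 < αD → 0 < αG →
      ∀ ωs : A.GParam → A.DParam, IsOptimalDisc (alphaLoss αD) Pr PZ ωs →
      ∀ δ : ℝ, 0 < δ → δ < 1 →
        ErrorBoundWithFailure μ (alphaLoss αG) ωs Pr PZ X Z (2 * δ)
          (4 * clipConst αG (A.Qx Bx) * A.Qx Bx * √(3 * ((A.K : ℝ) + 1)) / √n
            + 4 * clipConst αG (A.Qz Bz) * A.Qz Bz
                * √(3 * ((A.K : ℝ) + 1 + (A.L + 1) - 1)) / √m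
            + 2 * √(2 * Real.log (1 / δ))
              * (clipConst αG (A.Qx Bx) * A.Qx Bx / √n
                + clipConst αG (A.Qz Bz) * A.Qz Bz / √m))) := by
  refine ⟨?_, ?_, ?_⟩
  · intro ℓD ℓG hℓ ωs hωs x hx z hz θ hθ
    exact estError_le_uniformDev hBx hBz hℓ (fun θ hθ => (hωs θ hθ).1) hx hz hθ
  · intro ℓD ℓG Lφ Lψ hφ hψ ωs hωs δ hδ hδ1
    have hℓ : ∀ y, ContinuousOn (ℓG y) (Set.Ioo 0 1) := Fin.forall_fin_two.2
      ⟨hψ.continuousOn.neg.congr fun p _ => (neg_neg _).symm,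
        hφ.continuousOn.neg.congr fun p _ => (neg_neg _).symm⟩
    have key := errorBoundWithFailure_of_lipschitz hBx hBz hℓ (fun θ hθ => (hωs θ hθ).1)
      hX hXind hZ hZind hn hm (lipschitzWith_comp_sigmoid hφ).lipschitzOnWith
      (lipschitzWith_comp_sigmoid hψ).lipschitzOnWith hδ hδ1
    have htail : 2 * √(2 * Real.log (1 / δ)) *
          (((Lφ * (1 / 4) : ℝ≥0) : ℝ) * A.Qx Bx / √n + ((Lψ * (1 / 4) : ℝ≥0) : ℝ) * A.Qz Bz / √m)
        = √(Real.log (1 / δ)) * (Lφ * A.Qx Bx / √(2 * n) + Lψ * A.Qz Bz / √(2 * m)) := by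
      rw [mul_add, mul_add, ← two_mul_sqrt_mul_quarter_eq, ← two_mul_sqrt_mul_quarter_eq]
      push_cast
      ring
    rw [htail] at key
    refine ⟨key.1, ?_⟩
    -- The 4 in front of the Rademacher bound cancels the 1/4 from the sigmoid.
    convert key.2 using 3 <;> push_cast <;> ring
  · intro αD αG _ hαG ωs hωs δ hδ hδ1
    have key := (errorBoundWithFailure_of_lipschitz hBx hBz (continuousOn_alphaLoss hαG)
      (fun θ hθ => (hωs θ hθ).1) hX hXind hZ hZind hn hm
      (lipschitzOnWith_alphaLoss_sigmoid hαG _ 1) (lipschitzOnWith_alphaLoss_sigmoid hαG _ 0)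
      hδ hδ1).2
    rw [Real.coe_toNNReal _ (clipConst_nonneg hαG _),
      Real.coe_toNNReal _ (clipConst_nonneg hαG _)] at key
    convert key using 3 <;> ring
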